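/- **Setting.** Let $A\in\mathbb R^{n\times n}$, $B\in\mathbb R^{n\times m}$, and let $i$ range over a finite set of LQR tasks with positive definite $Q_i\in\mathbb R^{n\times n}$, $R_i\in\mathbb R^{m\times m}$ and a probability vector $(p_i)$; $\mathbb E_i$ is the expectation under $p$. Let $x_0\sim\mathcal D$ have finite second moment. For $W\in\mathbb R^{m\times n}$ let $C_i(W)=\mathbb E_{x_0}\sum_{t\ge 0}x_t^T(Q_i+W^TR_iW)x_t$, where $x_{t+1}=(A-BW)x_t$, and let $\mathcal S=\{W:\operatorname{rad}(A-BW)<1\}$ be the set of stabilizing parameters. Gradients and Hessians are with respect to the inner product $\operatorname{tr}(Z_1^TZ_2)$; $\|\cdot\|$ is the maximum singular value (for Hessians: of the operator on vectorized matrices) and $\|\cdot\|_F$ the Frobenius norm. For $\eta>0$ put $F_\eta(W)=\mathbb E_i\,C_i(W-\eta\nabla C_i(W))$ and $G_i(W)=I-\eta\nabla^2C_i(W)$. Call $W$ MAML-stabilizing (for $\eta$) if $W\in\mathcal S$ and $W-\eta\nabla C_i(W)\in\mathcal S$ for all $i$. Gradient-based MAML with step sizes $\eta_j,\beta_j$ is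 $$W_{j+1}=W_j-\beta_j\,\mathbb E_i\big[G_i(W_j)\,\nabla C_i(W_j-\eta_j\nabla C_i(W_j))\big]\qquad(\eta=\eta_j\text{ in }G_i).$$ Let $\mu=\sigma_{\min}(\mathbb E[x_0x_0^T])$, $$\delta_i(W)=\frac{\sigma_{\min}(Q_i)\mu}{4C_i(W)\|B\|(\|A-BW\|+1)},\quad \delta=\min_i\delta_i,\quad \bar\delta_i(W)=\frac{\sqrt{\|A-BW\|^2+\mu\sigma_{\min}(Q_i)/C_i(W)}-\|A-BW\|}{\|B\|}.$$ *Local Lipschitz constants* are functions $\ell_i,\rho_i$, bounded on compact subsets of $\mathcal S$, such that for all $W,U\in\mathcal S$ with $\|U-W\|\le\delta_i(W)$: $\|\nabla C_i(U)-\nabla C_i(W)\|\le\ell_i(W)\|U-W\|$, the same inequality in the Frobenius norm, and $\|\nabla^2C_i(U)-\nabla^2C_i(W)\|\le\rho_i(W)\|U-W\|$. Given them, let $\ell=\max_i\ell_i$, $\rho=\max_i\rho_i$, $\bar\ell(W)=\max_i\ell_i(W-\eta\nabla C_i(W))$, $H_i(W)=\int_0^1\nabla^2C_i(W-t\eta\nabla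 C_i(W))\,dt$, $\|H\|=\max_i\|H_i\|$ and $$L_\eta(W)=\bar\ell\,\big(1+\eta(\ell+\delta\rho)\big)(1+\eta\ell)+\eta\rho\,(1+\eta\|H\|)\,\mathbb E_i\|\nabla C_i(W)\|_F .$$ *Condition 1* at $W_j$, with $\alpha_j\in(0,1)$ and constants $a,b$ with $2a>b^2$ (a quotient with denominator $0$ in the bounds on $\eta_j$ or with $\nabla F=0$ is read as $+\infty$): $\eta_j>0$, $$\eta_j<\min_i\Big\{\frac1{4\|\nabla^2C_i(W_j)\|+2\rho_i(W_j)\delta_i(W_j)},\ \frac{(1-\alpha_j)\delta(W_j)}{\alpha_j\delta(W_j)\ell_i(W_j)+\|\nabla C_i(W_j)\|}\Big\},$$ $$\frac a{L_{\eta_j}(W_j)}<\beta_j<\frac b{L_{\eta_j}(W_j)}<\min_i\frac{\alpha_j\bar\delta_i(W_j)}{\|\nabla F_{\eta_j}(W_j)\|}.$$ **Theorem.** Local Lipschitz constants exist, and for every choice of them the following hold. 1. If $W_0\in\mathcal S$ and Condition 1 holds at every iteration, then every iterate $W_j$ is stabilizing, and even MAML-stabilizing for $\eta_j$. 2. Let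 $\mathcal W\subset\mathcal S$ be compact and let $\eta>0$. There are constants $\tilde c_1,\tilde c_2>0$, depending only on the tasks, $p$, $\mathcal D$, the $\ell_i,\rho_i$, $\mathcal W$ and $\eta$, with the following property. Let $\sigma>0$ satisfy $\mathbb E_i\|\nabla C_i(W)-\mathbb E_k\nabla C_k(W)\|_F^2\le\sigma^2$ for all $W\in\mathcal W$, and run the algorithm from some $W_0\in\mathcal W$ with $\eta_j=\eta$ for all $j$, such that at every iteration Condition 1 and $\beta_j\|\nabla F_\eta(W_j)\|<\alpha_j\min_i\delta_i(W_j)$ hold. Then for every $\epsilon>0$ there is an iteration $$N\le\frac{\Delta\,\big(\tilde c_1+\tilde c_2(\sigma+\epsilon)\big)}{(2a-b^2)\,\epsilon^2}$$ with $\|\nabla F_\eta(W_N)\|_F\le\epsilon$ (hence also $\|\nabla F_\eta(W_N)\|\le\epsilon$), where $\Delta=F_\eta(W_0)-\inf F_\eta$ and the infimum is over the MAML-stabilizing parameters. In particular $O(1/\epsilon^2)$ iterations suffice. -/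

import Mathlib

open MeasureTheory Matrix

noncomputable section

namespace LQR

/-- The maximum singular value of a real matrix (its operator norm between Euclidean spaces). -/
def specNorm {a b : ℕ} (M : Matrix (Fin a) (Fin b) ℝ) : ℝ :=
  ‖(Matrix.toEuclideanLin M).toContinuousLinearMap‖

/-- The minimum singular value of a real square matrix: the minimum of `‖M x‖` over unit `x`. -/
def sigmaMin {a : ℕ} (M : Matrix (Fin a) (Fin a) ℝ) : ℝ :=
  ⨅ x : Metric.sphere (0 : EuclideanSpace ℝ (Fin a)) 1, ‖Matrix.toEuclideanLin M x‖

/-- The spectral radius of `M` (over the complex numbers) is less than one. -/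
def IsSchurStable {a : ℕ} (M : Matrix (Fin a) (Fin a) ℝ) : Prop :=
  spectralRadius ℂ (M.map (algebraMap ℝ ℂ)) < 1

/-- The space of policy parameters `W ∈ ℝ^{m × n}` with the inner product `tr (Z₁ᵀ Z₂)`: the
norm of this type is the Frobenius norm, `gradient` is the gradient for that inner product, and
the operator norm on `Param m n →L[ℝ] Param m n` is the maximum singular value of the operator
acting on vectorized matrices. -/
abbrev Param (m n : ℕ) : Type := EuclideanSpace ℝ (Fin m × Fin n)

/-- The parameter as a matrix. -/
def Param.mat {m n : ℕ} (W : Param m n) : Matrix (Fin m) (Fin n) ℝ :=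
  Matrix.of fun k l => W (k, l)

/-- The maximum singular value of a parameter. -/
def Param.spec {m n : ℕ} (W : Param m n) : ℝ := specNorm W.mat

/-- A finite family of LQR tasks with common dynamics `(A, B)` and costs `(Q i, R i)`, a
probability vector `p` on the tasks and a distribution `D` of the initial state with finite
second moment. -/
structure Tasks (n m : ℕ) (ι : Type) [Fintype ι] where
  A : Matrix (Fin n) (Fin n) ℝ
  B : Matrix (Fin n) (Fin m) ℝ
  Q : ι → Matrix (Fin n) (Fin n) ℝ
  R : ι → Matrix (Fin m) (Fin m) ℝ
  posDef_Q : ∀ i, (Q i).PosDef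
  posDef_R : ∀ i, (R i).PosDef
  p : ι → ℝ
  p_nonneg : ∀ i, 0 ≤ p i
  p_sum : ∑ i, p i = 1
  D : Measure (Fin n → ℝ)
  prob_D : IsProbabilityMeasure D
  moment_D : Integrable (fun x : Fin n → ℝ => x ⬝ᵥ x) D

namespace Tasks

variable {n m : ℕ} {ι : Type} [Fintype ι] (T : Tasks n m ι)

/-- The closed-loop matrix `A - B W`. -/
def closedLoop (W : Param m n) : Matrix (Fin n) (Fin n) ℝ := T.A - T.B * W.mat

/-- The set `𝒮` of stabilizing parameters (the same set for every task). -/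
def stab : Set (Param m n) := {W | IsSchurStable (T.closedLoop W)}

/-- The state at time `t` under `u = -W x`, started at `x₀`. -/
def state (W : Param m n) (x₀ : Fin n → ℝ) : ℕ → (Fin n → ℝ)
  | 0 => x₀
  | t + 1 => T.A *ᵥ state W x₀ t + T.B *ᵥ (-(W.mat *ᵥ state W x₀ t))

/-- The LQR cost `C_i(W) = 𝔼 ∑ₜ xₜᵀ (Q_i + Wᵀ R_i W) xₜ`. -/
def cost (i : ι) (W : Param m n) : ℝ :=
  ∫ x₀, ∑' t : ℕ,
    (T.state W x₀ t ⬝ᵥ ((T.Q i + W.matᵀ * T.R i * W.mat) *ᵥ T.state W x₀ t)) ∂T.D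

/-- `∇C_i(W)`. -/
def grad (i : ι) (W : Param m n) : Param m n := gradient (T.cost i) W

/-- `∇²C_i(W)`, as an operator on parameters. -/
def hess (i : ι) (W : Param m n) : Param m n →L[ℝ] Param m n := fderiv ℝ (T.grad i) W

/-- The adapted parameter `W - η ∇C_i(W)`. -/
def adapt (η : ℝ) (i : ι) (W : Param m n) : Param m n := W - η • T.grad i W

/-- The MAML objective `F(W) = 𝔼_{i ∼ p} C_i(W - η ∇C_i(W))`. -/
def objective (η : ℝ) (W : Param m n) : ℝ := ∑ i, T.p i * T.cost i (T.adapt η i W)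

/-- `∇F(W)`. -/
def gradF (η : ℝ) (W : Param m n) : Param m n := gradient (T.objective η) W

/-- The set of MAML-stabilizing parameters. -/
def mamlStab (η : ℝ) : Set (Param m n) := {W | W ∈ T.stab ∧ ∀ i, T.adapt η i W ∈ T.stab}

/-- The optimal value of the MAML objective over the MAML-stabilizing parameters; it is
`F(W*)` whenever a minimizer `W*` exists. -/
def optValue (η : ℝ) : ℝ := sInf (T.objective η '' T.mamlStab η)

/-- `G_i(W) = I - η ∇²C_i(W)`. -/
def G (η : ℝ) (i : ι) (W : Param m n) : Param m n →L[ℝ] Param m n :=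
  ContinuousLinearMap.id ℝ (Param m n) - η • T.hess i W

/-- `W` is a run of gradient-based MAML with step sizes `η j`, `β j` at iteration `j`. -/
def IsRun (η β : ℕ → ℝ) (W : ℕ → Param m n) : Prop :=
  ∀ j, W (j + 1) =
    W j - β j • ∑ i, T.p i • T.G (η j) i (W j) (T.grad i (T.adapt (η j) i (W j)))

/-- `μ`, the minimum singular value of the second moment matrix of the initial state. -/
def mu : ℝ := sigmaMin (Matrix.of fun k l => ∫ x, x k * x l ∂T.D)

/-- `δ_i(W)`. -/
def delta (i : ι) (W : Param m n) : ℝ :=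
  sigmaMin (T.Q i) * T.mu /
    (4 * T.cost i W * specNorm T.B * (specNorm (T.closedLoop W) + 1))

/-- `δ(W) = min_i δ_i(W)`. -/
def deltaMin (W : Param m n) : ℝ := ⨅ i, T.delta i W

/-- `δ̄_i(W)`. -/
def deltaBar (i : ι) (W : Param m n) : ℝ :=
  (√(specNorm (T.closedLoop W) ^ 2 + T.mu * sigmaMin (T.Q i) / T.cost i W)
    - specNorm (T.closedLoop W)) / specNorm T.B

/-- `ℓ i W` and `ρ i W` are local Lipschitz constants at `W` of the gradient and of the Hessian
of `C_i`, valid for stabilizing `U` with `‖U - W‖ ≤ δ_i(W)`, and locally bounded on `𝒮`. The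
gradient inequality is meant for the spectral norm and for the Frobenius norm. -/
structure IsLipschitz (ℓ ρ : ι → Param m n → ℝ) : Prop where
  grad_spec : ∀ i, ∀ W ∈ T.stab, ∀ U ∈ T.stab, (U - W).spec ≤ T.delta i W →
    (T.grad i U - T.grad i W).spec ≤ ℓ i W * (U - W).spec
  grad_frob : ∀ i, ∀ W ∈ T.stab, ∀ U ∈ T.stab, (U - W).spec ≤ T.delta i W →
    ‖T.grad i U - T.grad i W‖ ≤ ℓ i W * ‖U - W‖
  hess : ∀ i, ∀ W ∈ T.stab, ∀ U ∈ T.stab, (U - W).spec ≤ T.delta i W →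
    ‖T.hess i U - T.hess i W‖ ≤ ρ i W * (U - W).spec
  bdd : ∀ i, ∀ K ⊆ T.stab, IsCompact K → ∃ M, ∀ W ∈ K, ℓ i W ≤ M ∧ ρ i W ≤ M

/-- The mean-value operator `H_i(W)`, with `∇C_i(U) - ∇C_i(W) = H_i(W) (U - W)` for the adapted
parameter `U = W - η ∇C_i(W)`: the average of the Hessian over the segment from `W` to `U`. -/
def meanHess (η : ℝ) (i : ι) (W : Param m n) : Param m n →L[ℝ] Param m n :=
  ∫ t in (0 : ℝ)..1, T.hess i (T.adapt (t * η) i W)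

/-- `L(W) = ℓ̄ (1 + η (ℓ + δ ρ)) (1 + η ℓ) + η ρ (1 + η ‖H‖) 𝔼_i ‖∇C_i(W)‖_F`, with the maxima
over the tasks `ℓ = max ℓ_i(W)`, `ℓ̄ = max ℓ_i(W - η ∇C_i(W))`, `ρ = max ρ_i(W)`,
`‖H‖ = max ‖H_i(W)‖`. -/
def L (ℓ ρ : ι → Param m n → ℝ) (η : ℝ) (W : Param m n) : ℝ :=
  (⨆ i, ℓ i (T.adapt η i W)) * (1 + η * ((⨆ i, ℓ i W) + T.deltaMin W * ⨆ i, ρ i W))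
      * (1 + η * ⨆ i, ℓ i W)
    + η * (⨆ i, ρ i W) * (1 + η * ⨆ i, ‖T.meanHess η i W‖) * ∑ i, T.p i * ‖T.grad i W‖

/-- The step-size condition at a parameter `W`, for the inner step `η` and the outer step `β`.
A bound `s < x / y` with `y` possibly zero is written `s * y < x`. -/
structure StepCondition (ℓ ρ : ι → Param m n → ℝ) (α a b η β : ℝ) (W : Param m n) : Prop where
  alpha_pos : 0 < α
  alpha_lt : α < 1
  eta_pos : 0 < η
  eta_hess : ∀ i, η * (4 * ‖T.hess i W‖ + 2 * ρ i W * T.delta i W) < 1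
  eta_stab : ∀ i, η * (α * T.deltaMin W * ℓ i W + (T.grad i W).spec) < (1 - α) * T.deltaMin W
  beta_gt : a / T.L ℓ ρ η W < β
  beta_lt : β < b / T.L ℓ ρ η W
  beta_stab : ∀ i, b / T.L ℓ ρ η W * (T.gradF η W).spec < α * T.deltaBar i W

/-- The variance of the task gradients is at most `σ²` on `𝒲`. -/
def BoundedVariance (𝒲 : Set (Param m n)) (σ : ℝ) : Prop :=
  ∀ W ∈ 𝒲, ∑ i, T.p i * ‖T.grad i W - ∑ k, T.p k • T.grad k W‖ ^ 2 ≤ σ ^ 2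

end Tasks

end LQR

end

/-! Write M = A - BW and Σ = 𝔼 x₀x₀ᵀ. On 𝒮 the cost is tr((Q_i + WᵀR_iW) X), where X = ∑ Mᵗ Σ (Mᵗ)ᵀ
solves X = M X Mᵀ + Σ (`cost_eq`). Since X arises by inverting 1 - (Z ↦ M Z Mᵀ), the cost is smooth
on the open set 𝒮, and suprema of derivatives over compact tubes provide local Lipschitz constants.

Stability is made quantitative by keeping the X of W as a Lyapunov certificate for a nearby U.
Because X ≥ μI and σ_min(Q_i)‖X‖ ≤ C_i(W), the certificate survives as long as 2‖A - BW‖d + d² <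
μσ_min(Q_i)/C_i(W) with d = ‖B‖‖U - W‖ (`mem_stab_of_perturbation`). The radius δ̄_i is the exact
threshold of this inequality and δ_i is a simpler, smaller radius. If σ_min(Q_i), μ or ‖B‖ vanishes,
then δ_i = 0 and Condition 1 cannot hold.

Under Condition 1 the inner step is shorter than δ and does not raise the cost, and along such a
step δ_i drops by at most the length of the step (`Regular.delta_sub_le`). Hence the local constants
at the adapted parameter control the adapted images of all U with ‖U - W‖ ≤ αδ(W). There ∇F differs
from ∇F(W) by at most L‖U - W‖ (`norm_gradF_sub_le`). Symmetry of the Hessian makes the MAML update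
an exact gradient step on F, so a/L < β < b/L yields a decrease of at least (2a - b²)/(2L) ‖∇F‖².

The rate needs one bound on L along the run, where F stays below its initial value. Boundedness of F
bounds C_i at the adapted parameter for a task of positive probability, and sublevel sets of C_i are
compact in 𝒮. Either W is near such a set, or δ_i(W) is bounded below and so C_i(W) is bounded
(`exists_compact_of_objective_le`). Telescoping the decrease finishes the count. -/

noncomputable section

open MeasureTheory Matrix Filter Topology
open scoped Matrix.Norms.L2Operator RealInnerProductSpace

namespace LQR

/-! ### Lyapunov-type equations in a Banach algebra -/

section BanachAlgebra

variable {A : Type*} [NormedRing A] [NormedAlgebra ℝ A]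

/-- The operator `z ↦ x z y` on a normed algebra. -/
def sandwich (x y : A) : A →L[ℝ] A := ContinuousLinearMap.mulLeftRight ℝ A x y

theorem sandwich_apply (x y z : A) : sandwich x y z = x * z * y := rfl

theorem sandwich_pow (x y : A) (t : ℕ) : sandwich x y ^ t = sandwich (x ^ t) (y ^ t) := by
  induction t with
  | zero => ext1 z; simp [sandwich_apply]
  | succ t ih =>
    ext1 z
    rw [pow_succ, ih, mul_apply_eq_comp]
    simp only [sandwich_apply, pow_succ x, pow_succ' y, mul_assoc]

theorem summable_sandwich_pow [CompleteSpace A] {x y : A} {c r : ℝ} (hr0 : 0 ≤ r) (hr1 : r < 1)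
    (hx : ∀ᶠ t : ℕ in atTop, ‖x ^ t‖ ≤ c * r ^ t) (hy : ∀ᶠ t : ℕ in atTop, ‖y ^ t‖ ≤ c * r ^ t) :
    Summable fun t : ℕ => sandwich x y ^ t := by
  have hs : Summable fun t : ℕ => c * c * (r * r) ^ t :=
    (summable_geometric_of_lt_one (by positivity) (by nlinarith)).mul_left _
  refine hs.of_norm_bounded_eventually_nat ?_
  filter_upwards [hx, hy] with t hxt hyt
  rw [sandwich_pow]
  calc ‖sandwich (x ^ t) (y ^ t)‖ ≤ ‖x ^ t‖ * ‖y ^ t‖ :=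
        ContinuousLinearMap.opNorm_mulLeftRight_apply_apply_le ℝ _ _ _
    _ ≤ (c * r ^ t) * (c * r ^ t) :=
        mul_le_mul hxt hyt (norm_nonneg _) ((norm_nonneg _).trans hxt)
    _ = c * c * (r * r) ^ t := by rw [mul_pow]; ring

/-- The solution of the Lyapunov type equation `w = x w y + z`. -/
def sandwichSolve (x y z : A) : A := Ring.inverse (1 - sandwich x y) z

theorem isUnit_one_sub_sandwich {x y : A} (h : Summable fun t : ℕ => sandwich x y ^ t) :
    IsUnit (1 - sandwich x y) :=
  ⟨⟨1 - sandwich x y, ∑' t : ℕ, sandwich x y ^ t, h.one_sub_mul_tsum_pow,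
    h.tsum_pow_mul_one_sub⟩, rfl⟩

theorem hasSum_sandwichSolve {x y : A} (h : Summable fun t : ℕ => sandwich x y ^ t) (z : A) :
    HasSum (fun t : ℕ => x ^ t * z * y ^ t) (sandwichSolve x y z) := by
  have h1 := (ContinuousLinearMap.apply ℝ A z).hasSum h.hasSum
  have h2 : Ring.inverse (1 - sandwich x y) = ∑' t : ℕ, sandwich x y ^ t :=
    Ring.inverse_unit (⟨1 - sandwich x y, ∑' t : ℕ, sandwich x y ^ t, h.one_sub_mul_tsum_pow,
      h.tsum_pow_mul_one_sub⟩ : (A →L[ℝ] A)ˣ)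
  rw [sandwichSolve, h2]
  simpa [Function.comp_def, sandwich_pow, sandwich_apply] using! h1

theorem sandwichSolve_sub {x y : A} (h : Summable fun t : ℕ => sandwich x y ^ t) (z : A) :
    sandwichSolve x y z - x * sandwichSolve x y z * y = z := by
  have h1 : (1 - sandwich x y) (sandwichSolve x y z) = z := by
    rw [sandwichSolve, ← mul_apply_eq_comp, Ring.mul_inverse_cancel _ (isUnit_one_sub_sandwich h)]
    rfl
  exact h1

/-- Inversion is smooth at units of the algebra of operators, so no term-by-term differentiation of
the series is needed. -/
theorem contDiffAt_sandwichSolve [CompleteSpace A]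
    {E : Type*} [NormedAddCommGroup E] [NormedSpace ℝ E]
    {f g : E → A} {e : E} {k : WithTop ℕ∞} (hf : ContDiffAt ℝ k f e) (hg : ContDiffAt ℝ k g e)
    (h : Summable fun t : ℕ => sandwich (f e) (g e) ^ t) (z : A) :
    ContDiffAt ℝ k (fun e => sandwichSolve (f e) (g e) z) e := by
  have h0 : ContDiffAt ℝ k (fun e => ContinuousLinearMap.mulLeftRight ℝ A (f e)) e := by
    have h := ContinuousLinearMap.contDiff (n := k) (𝕜 := ℝ) (E := A) (F := A →L[ℝ] A →L[ℝ] A)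
      (ContinuousLinearMap.mulLeftRight ℝ A)
    exact h.contDiffAt.comp e hf
  have h1 : ContDiffAt ℝ k (fun e => 1 - sandwich (f e) (g e)) e :=
    contDiffAt_const.sub (h0.clm_apply hg)
  have h2 : ContDiffAt ℝ k (Ring.inverse : (A →L[ℝ] A) → _) (1 - sandwich (f e) (g e)) := by
    obtain ⟨u, hu⟩ := isUnit_one_sub_sandwich h
    rw [← hu]
    exact contDiffAt_ringInverse ℝ u
  exact (h2.comp e h1).clm_apply contDiffAt_const

end BanachAlgebra

/-! ### Spectral radius, geometric decay and the Lyapunov equation -/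

section Stability

variable {n : ℕ}

theorem specNorm_eq_norm {a b : ℕ} (M : Matrix (Fin a) (Fin b) ℝ) : specNorm M = ‖M‖ := rfl

theorem norm_transpose {a b : ℕ} (M : Matrix (Fin a) (Fin b) ℝ) : ‖Mᵀ‖ = ‖M‖ := by
  rw [← Matrix.conjTranspose_eq_transpose_of_trivial, Matrix.l2_opNorm_conjTranspose]

/-- In a complex Banach algebra, spectral radius below one forces geometric decay of powers. -/
theorem exists_norm_pow_le_of_spectralRadius_lt_one {A : Type*} [NormedRing A] [NormedAlgebra ℂ A]
    [CompleteSpace A] {a : A} (h : spectralRadius ℂ a < 1) :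
    ∃ r : ℝ, 0 ≤ r ∧ r < 1 ∧ ∀ᶠ t : ℕ in atTop, ‖a ^ t‖ ≤ r ^ t := by
  obtain ⟨r, hr1, hr2⟩ := ENNReal.lt_iff_exists_nnreal_btwn.1 h
  refine ⟨r, r.2, by exact_mod_cast hr2, ?_⟩
  filter_upwards [(spectrum.pow_nnnorm_pow_one_div_tendsto_nhds_spectralRadius a).eventually
    (gt_mem_nhds hr1), eventually_gt_atTop 0] with t ht ht0
  have h1 : ((‖a ^ t‖₊ : ENNReal) ^ (1 / t : ℝ)) ^ (t : ℝ) ≤ (r : ENNReal) ^ (t : ℝ) :=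
    ENNReal.rpow_le_rpow ht.le (by positivity)
  rw [← ENNReal.rpow_mul, one_div_mul_cancel (by positivity), ENNReal.rpow_one,
    ENNReal.rpow_natCast] at h1
  have h2 : ‖a ^ t‖₊ ≤ r ^ t := by exact_mod_cast h1
  exact_mod_cast h2

theorem spectralRadius_lt_one_of_norm_pow {A : Type*} [NormedRing A] [NormedAlgebra ℂ A]
    [CompleteSpace A] {a : A} {t : ℕ} (h : ‖a ^ (t + 1)‖ * ‖(1 : A)‖ < 1) :
    spectralRadius ℂ a < 1 := by
  refine (spectrum.spectralRadius_le_pow_nnnorm_pow_one_div ℂ a t).trans_lt ?_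
  rw [← ENNReal.mul_rpow_of_nonneg _ _ (by positivity)]
  refine ENNReal.rpow_lt_one ?_ (by positivity)
  have : ‖a ^ (t + 1)‖₊ * ‖(1 : A)‖₊ < 1 := by exact_mod_cast h
  exact_mod_cast this

/-- Some single power has small norm. This is an open condition, and it bounds the spectral radius
in turn. The factor `‖1‖` appears because the unit is not assumed to have norm one. -/
theorem isOpen_spectralRadius_lt_one {A : Type*} [NormedRing A] [NormedAlgebra ℂ A]
    [CompleteSpace A] : IsOpen {a : A | spectralRadius ℂ a < 1} := by
  rw [isOpen_iff_mem_nhds]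
  intro a ha
  obtain ⟨r, hr0, hr1, hr⟩ := exists_norm_pow_le_of_spectralRadius_lt_one ha
  have h1 : Tendsto (fun t : ℕ => r ^ t * ‖(1 : A)‖) atTop (𝓝 0) := by
    simpa using (tendsto_pow_atTop_nhds_zero_of_lt_one hr0 hr1).mul_const ‖(1 : A)‖
  obtain ⟨t, ht1, ht2, ht3⟩ :=
    ((h1.eventually (gt_mem_nhds one_pos)).and (hr.and (eventually_gt_atTop 0))).exists
  obtain ⟨s, rfl⟩ := Nat.exists_eq_succ_of_ne_zero ht3.ne'
  have h2 : ‖a ^ (s + 1)‖ * ‖(1 : A)‖ < 1 :=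
    (mul_le_mul_of_nonneg_right ht2 (norm_nonneg _)).trans_lt ht1
  have h3 : ∀ᶠ b in 𝓝 a, ‖b ^ (s + 1)‖ * ‖(1 : A)‖ < 1 :=
    ((by fun_prop : Continuous fun b : A => ‖b ^ (s + 1)‖ * ‖(1 : A)‖).tendsto a).eventually
      (gt_mem_nhds h2)
  filter_upwards [h3] with b hb using spectralRadius_lt_one_of_norm_pow hb

/-- The complexification of a real matrix. -/
def complexify : Matrix (Fin n) (Fin n) ℝ →ₗ[ℝ] Matrix (Fin n) (Fin n) ℂ where
  toFun M := M.map (algebraMap ℝ ℂ)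
  map_add' M N := by ext; simp
  map_smul' c M := by ext; simp

theorem complexify_pow (M : Matrix (Fin n) (Fin n) ℝ) (t : ℕ) :
    complexify (M ^ t) = complexify M ^ t :=
  Matrix.map_pow M (algebraMap ℝ ℂ) t

theorem complexify_injective : Function.Injective (complexify (n := n)) := fun M N h => by
  ext i j
  simpa [complexify] using congrFun (congrFun h i) j

theorem continuous_complexify : Continuous (complexify (n := n)) :=
  LinearMap.continuous_of_finiteDimensional _

theorem isOpen_isSchurStable : IsOpen {M : Matrix (Fin n) (Fin n) ℝ | IsSchurStable M} :=
  isOpen_spectralRadius_lt_one.preimage continuous_complexify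

/-- The decay holds for the complexified powers; an injective linear map in finite dimension is
antilipschitz, which brings it back to the real matrix at the price of a constant. -/
theorem IsSchurStable.exists_norm_pow_le {M : Matrix (Fin n) (Fin n) ℝ} (h : IsSchurStable M) :
    ∃ c r : ℝ, 0 ≤ c ∧ 0 ≤ r ∧ r < 1 ∧ ∀ᶠ t : ℕ in atTop, ‖M ^ t‖ ≤ c * r ^ t := by
  obtain ⟨r, hr0, hr1, hr⟩ := exists_norm_pow_le_of_spectralRadius_lt_one
    (a := complexify M) h
  obtain ⟨K, -, hK⟩ := LinearMap.exists_antilipschitzWith (complexify (n := n))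
    (LinearMap.ker_eq_bot.2 complexify_injective)
  refine ⟨K, r, K.2, hr0, hr1, ?_⟩
  filter_upwards [hr] with t ht
  have := hK.le_mul_dist (M ^ t) 0
  simp only [dist_zero_right, map_zero, complexify_pow] at this
  exact this.trans (mul_le_mul_of_nonneg_left ht K.2)

theorem isSchurStable_of_tendsto {M : Matrix (Fin n) (Fin n) ℝ}
    (h : Tendsto (fun t : ℕ => M ^ t) atTop (𝓝 0)) : IsSchurStable M := by
  have h1 : Tendsto (fun t : ℕ => complexify M ^ (t + 1)) atTop (𝓝 0) := by
    have := ((continuous_complexify (n := n)).tendsto 0).comp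
      (h.comp (tendsto_add_atTop_nat 1))
    simpa [Function.comp_def, complexify_pow] using this
  have h2 : Tendsto (fun t : ℕ => ‖complexify M ^ (t + 1)‖ * ‖(1 : Matrix (Fin n) (Fin n) ℂ)‖)
      atTop (𝓝 0) := by
    simpa using h1.norm.mul_const ‖(1 : Matrix (Fin n) (Fin n) ℂ)‖
  obtain ⟨t, ht⟩ := (h2.eventually (gt_mem_nhds one_pos)).exists
  exact spectralRadius_lt_one_of_norm_pow (a := complexify M) ht

theorem IsSchurStable.summable {M : Matrix (Fin n) (Fin n) ℝ} (h : IsSchurStable M) :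
    Summable fun t : ℕ => sandwich M Mᵀ ^ t := by
  obtain ⟨c, r, hc, hr0, hr1, hr⟩ := h.exists_norm_pow_le
  refine summable_sandwich_pow hr0 hr1 hr ?_
  filter_upwards [hr] with t ht
  rwa [← Matrix.transpose_pow, norm_transpose]

/-- The solution of the discrete Lyapunov equation `X = M X Mᵀ + Y`. -/
def lyap (M Y : Matrix (Fin n) (Fin n) ℝ) : Matrix (Fin n) (Fin n) ℝ := sandwichSolve M Mᵀ Y

theorem IsSchurStable.hasSum_lyap {M : Matrix (Fin n) (Fin n) ℝ} (h : IsSchurStable M)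
    (Y : Matrix (Fin n) (Fin n) ℝ) :
    HasSum (fun t : ℕ => M ^ t * Y * (M ^ t)ᵀ) (lyap M Y) := by
  simp only [Matrix.transpose_pow]
  exact hasSum_sandwichSolve h.summable Y

theorem IsSchurStable.lyap_eq {M : Matrix (Fin n) (Fin n) ℝ} (h : IsSchurStable M)
    (Y : Matrix (Fin n) (Fin n) ℝ) : M * lyap M Y * Mᵀ = lyap M Y - Y := by
  rw [eq_sub_iff_add_eq, ← eq_sub_iff_add_eq']
  exact (sandwichSolve_sub h.summable Y).symm

end Stability

/-! ### Trace and norm estimates for semidefinite matrices; Lyapunov certificates -/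

section PosSemidef

variable {n : ℕ}

theorem sigmaMin_nonneg (M : Matrix (Fin n) (Fin n) ℝ) : 0 ≤ sigmaMin M :=
  Real.iInf_nonneg fun _ => norm_nonneg _

theorem sigmaMin_le {M : Matrix (Fin n) (Fin n) ℝ} {x : EuclideanSpace ℝ (Fin n)} (hx : ‖x‖ = 1) :
    sigmaMin M ≤ ‖Matrix.toEuclideanLin M x‖ :=
  ciInf_le (f := fun x : Metric.sphere (0 : EuclideanSpace ℝ (Fin n)) 1 =>
      ‖Matrix.toEuclideanLin M x‖) ⟨0, by rintro _ ⟨x, rfl⟩; exact norm_nonneg _⟩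
    ⟨x, by simpa using hx⟩

/-- A unit eigenvector v of P - sI with eigenvalue l satisfies Pv = (l + s)v with l + s ≥ 0, hence l
+ s = ‖Pv‖ ≥ s. -/
theorem posSemidef_sub_smul_one {P : Matrix (Fin n) (Fin n) ℝ} (hP : P.PosSemidef) {s : ℝ}
    (hs : ∀ x : EuclideanSpace ℝ (Fin n), ‖x‖ = 1 → s ≤ ‖Matrix.toEuclideanLin P x‖) :
    (P - s • (1 : Matrix (Fin n) (Fin n) ℝ)).PosSemidef := by
  have hH : (P - s • (1 : Matrix (Fin n) (Fin n) ℝ)).IsHermitian :=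
    hP.isHermitian.sub (by simp [Matrix.IsHermitian])
  rw [hH.posSemidef_iff_eigenvalues_nonneg]
  intro j
  have h1 := hH.mulVec_eigenvectorBasis j
  set v := hH.eigenvectorBasis j with hv
  set l := hH.eigenvalues j
  have hv1 : ‖v‖ = 1 := hH.eigenvectorBasis.orthonormal.1 j
  have h2 : P *ᵥ v.ofLp = (l + s) • v.ofLp := by
    rw [Matrix.sub_mulVec, Matrix.smul_mulVec, Matrix.one_mulVec] at h1
    rw [add_smul, ← h1]
    abel
  have hvv : v.ofLp ⬝ᵥ v.ofLp = 1 := by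
    have := EuclideanSpace.real_norm_sq_eq v
    rw [hv1] at this
    simpa [dotProduct, sq] using this.symm
  have h3 : 0 ≤ l + s := by
    have := hP.dotProduct_mulVec_nonneg v.ofLp
    rw [h2] at this
    simpa [hvv] using this
  have h4 : Matrix.toEuclideanLin P v = (l + s) • v := by
    ext i
    simpa using congrFun h2 i
  have h5 := hs v hv1
  rw [h4, norm_smul, hv1, mul_one, Real.norm_of_nonneg h3] at h5
  simp only [Pi.zero_apply]
  linarith

theorem posSemidef_sub_sigmaMin {P : Matrix (Fin n) (Fin n) ℝ} (hP : P.PosSemidef) :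
    (P - sigmaMin P • (1 : Matrix (Fin n) (Fin n) ℝ)).PosSemidef :=
  posSemidef_sub_smul_one hP fun _ hx => sigmaMin_le hx

/-- From 1 = ‖P⁻¹Px‖ ≤ ‖P⁻¹‖‖Px‖. The explicit constant is positive even in dimension zero, where
`sigmaMin` is an infimum over the empty set and equals 0. -/
theorem exists_posSemidef_sub_of_posDef {P : Matrix (Fin n) (Fin n) ℝ} (hP : P.PosDef) :
    ∃ s : ℝ, 0 < s ∧ (P - s • (1 : Matrix (Fin n) (Fin n) ℝ)).PosSemidef := by
  refine ⟨(‖P⁻¹‖ + 1)⁻¹, by positivity, posSemidef_sub_smul_one hP.posSemidef fun x hx => ?_⟩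
  have h1 : P⁻¹ * P = 1 :=
    Matrix.nonsing_inv_mul _ ((Matrix.isUnit_iff_isUnit_det _).1 hP.isUnit)
  have h2 := Matrix.l2_opNorm_mulVec P⁻¹ (Matrix.toEuclideanLin P x)
  have h3 : WithLp.toLp 2 (P⁻¹ *ᵥ (Matrix.toEuclideanLin P x).ofLp) = x := by
    ext i
    simp [Matrix.mulVec_mulVec, h1]
  have h4 : (1 : ℝ) ≤ ‖P⁻¹‖ * ‖Matrix.toEuclideanLin P x‖ := by
    rw [← hx]
    nth_rewrite 1 [← h3]
    exact h2
  rw [inv_le_iff_one_le_mul₀ (by positivity)]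
  nlinarith [norm_nonneg (Matrix.toEuclideanLin P x)]

open scoped MatrixOrder in
theorem exists_eq_star_mul_self {X : Matrix (Fin n) (Fin n) ℝ} (hX : X.PosSemidef) :
    ∃ Y : Matrix (Fin n) (Fin n) ℝ, X = star Y * Y :=
  CStarAlgebra.nonneg_iff_eq_star_mul_self.mp (nonneg_iff_posSemidef.2 hX)

/-- With X = YᴴY the trace equals that of the semidefinite matrix Y P Yᴴ. -/
theorem trace_mul_nonneg {P X : Matrix (Fin n) (Fin n) ℝ} (hP : P.PosSemidef)
    (hX : X.PosSemidef) : 0 ≤ (P * X).trace := by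
  obtain ⟨Y, rfl⟩ := exists_eq_star_mul_self hX
  rw [← Matrix.mul_assoc, Matrix.trace_mul_comm, ← Matrix.mul_assoc]
  exact (hP.mul_mul_conjTranspose_same Y).trace_nonneg

theorem norm_sq_le_trace {a b : ℕ} (M : Matrix (Fin a) (Fin b) ℝ) :
    ‖M‖ ^ 2 ≤ (M * Mᵀ).trace := by
  have h0 : (M * Mᵀ).trace = ∑ i, ∑ j, M i j ^ 2 := by
    simp [Matrix.trace, Matrix.mul_apply, sq]
  have hnn : 0 ≤ ∑ i, ∑ j, M i j ^ 2 := by positivity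
  rw [h0, ← Real.le_sqrt (norm_nonneg _) hnn]
  refine ContinuousLinearMap.opNorm_le_bound _ (Real.sqrt_nonneg _) fun x => ?_
  rw [← Real.sqrt_sq (norm_nonneg x), ← Real.sqrt_mul hnn]
  refine Real.le_sqrt_of_sq_le ?_
  rw [EuclideanSpace.real_norm_sq_eq, EuclideanSpace.real_norm_sq_eq, Finset.sum_mul]
  refine Finset.sum_le_sum fun i _ => ?_
  simpa [Matrix.mulVec, dotProduct] using Finset.sum_mul_sq_le_sq_mul_sq Finset.univ (M i) x

theorem dotProduct_mulVec_le_norm (X : Matrix (Fin n) (Fin n) ℝ) (v : Fin n → ℝ) :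
    v ⬝ᵥ (X *ᵥ v) ≤ ‖X‖ * (v ⬝ᵥ v) := by
  have h1 : v ⬝ᵥ (X *ᵥ v) = inner ℝ (WithLp.toLp 2 v) (WithLp.toLp 2 (X *ᵥ v)) := by
    simp [PiLp.inner_apply, dotProduct, mul_comm]
  have h2 : v ⬝ᵥ v = ‖WithLp.toLp 2 v‖ ^ 2 := by
    rw [EuclideanSpace.real_norm_sq_eq]
    simp [dotProduct, sq]
  rw [h1, h2]
  calc inner ℝ (WithLp.toLp 2 v) (WithLp.toLp 2 (X *ᵥ v))
      ≤ ‖WithLp.toLp 2 v‖ * ‖WithLp.toLp 2 (X *ᵥ v)‖ := real_inner_le_norm _ _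
    _ ≤ ‖WithLp.toLp 2 v‖ * (‖X‖ * ‖WithLp.toLp 2 v‖) :=
        mul_le_mul_of_nonneg_left (Matrix.l2_opNorm_mulVec X (WithLp.toLp 2 v)) (norm_nonneg _)
    _ = ‖X‖ * ‖WithLp.toLp 2 v‖ ^ 2 := by ring

theorem posSemidef_smul_one_sub {X : Matrix (Fin n) (Fin n) ℝ} (hX : X.IsHermitian) {k : ℝ}
    (hk : ‖X‖ ≤ k) : (k • (1 : Matrix (Fin n) (Fin n) ℝ) - X).PosSemidef := by
  refine .of_dotProduct_mulVec_nonneg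
    (.sub (by simp [Matrix.IsHermitian]) hX) fun v => ?_
  have h0 : 0 ≤ v ⬝ᵥ v := Finset.sum_nonneg fun i _ => mul_self_nonneg (v i)
  have h1 := dotProduct_mulVec_le_norm X v
  have h2 := mul_le_mul_of_nonneg_right hk h0
  simp only [star_trivial, Matrix.sub_mulVec, Matrix.smul_mulVec, Matrix.one_mulVec,
    dotProduct_sub, dotProduct_smul, smul_eq_mul]
  linarith

theorem norm_le_trace {X : Matrix (Fin n) (Fin n) ℝ} (hX : X.PosSemidef) : ‖X‖ ≤ X.trace := by
  obtain ⟨Y, rfl⟩ := exists_eq_star_mul_self hX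
  rw [CStarRing.norm_star_mul_self, ← sq]
  refine (norm_sq_le_trace Y).trans_eq ?_
  rw [Matrix.trace_mul_comm]
  rfl

theorem le_trace_mul {P X : Matrix (Fin n) (Fin n) ℝ} {s : ℝ}
    (hP : (P - s • (1 : Matrix (Fin n) (Fin n) ℝ)).PosSemidef)
    (hX : X.PosSemidef) : s * X.trace ≤ (P * X).trace := by
  have := trace_mul_nonneg hP hX
  rw [Matrix.sub_mul, Matrix.trace_sub, Matrix.smul_mul, Matrix.one_mul, Matrix.trace_smul] at this
  simpa using this

theorem isClosed_posSemidef : IsClosed {X : Matrix (Fin n) (Fin n) ℝ | X.PosSemidef} := by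
  have : {X : Matrix (Fin n) (Fin n) ℝ | X.PosSemidef} =
      {X | Xᴴ = X} ∩ ⋂ v : Fin n → ℝ, {X | 0 ≤ star v ⬝ᵥ (X *ᵥ v)} := by
    ext X
    simp [Matrix.posSemidef_iff_dotProduct_mulVec, Matrix.IsHermitian]
  rw [this]
  refine (isClosed_eq (by fun_prop) (by fun_prop)).inter (isClosed_iInter fun v => ?_)
  exact isClosed_le (by fun_prop) (by fun_prop)

theorem IsSchurStable.lyap_posSemidef {M Y : Matrix (Fin n) (Fin n) ℝ} (h : IsSchurStable M)
    (hY : Y.PosSemidef) : (lyap M Y).PosSemidef := by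
  refine isClosed_posSemidef.mem_of_tendsto (h.hasSum_lyap Y) (Eventually.of_forall fun s => ?_)
  refine Matrix.posSemidef_sum _ fun t _ => ?_
  simpa using hY.mul_mul_conjTranspose_same (M ^ t)

theorem IsSchurStable.lyap_sub_posSemidef {M Y : Matrix (Fin n) (Fin n) ℝ} (h : IsSchurStable M)
    (hY : Y.PosSemidef) : (lyap M Y - Y).PosSemidef := by
  rw [← h.lyap_eq]
  simpa using (h.lyap_posSemidef hY).mul_mul_conjTranspose_same M

/-- A strict Lyapunov certificate implies Schur stability. -/
theorem isSchurStable_of_certificate {M X : Matrix (Fin n) (Fin n) ℝ} {s e : ℝ} (hs : 0 < s)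
    (he : 0 < e) (hX : X.PosSemidef) (hXs : (X - s • (1 : Matrix (Fin n) (Fin n) ℝ)).PosSemidef)
    (hM : (X - M * X * Mᵀ - e • (1 : Matrix (Fin n) (Fin n) ℝ)).PosSemidef) :
    IsSchurStable M := by
  -- Since X ≤ kI, the slack eI dominates (e/k)X, so the additive decrease becomes a contraction M X
  -- Mᵀ ≤ cX. Adding e to ‖X‖ keeps k > 0 and c ≥ 0.
  set k := ‖X‖ + e with hk
  have hk0 : 0 < k := by positivity
  set c := 1 - e / k with hc
  have hc0 : 0 ≤ c := by
    rw [hc, sub_nonneg, div_le_one hk0, hk]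
    linarith [norm_nonneg X]
  have hc1 : c < 1 := by
    have := div_pos he hk0
    linarith
  have hstep : (c • X - M * X * Mᵀ).PosSemidef := by
    have h1 := (posSemidef_smul_one_sub hX.isHermitian (k := k) (by linarith)).smul
      (div_pos he hk0).le
    have h2 := hM.add h1
    convert h2 using 1
    rw [hc, smul_sub, smul_smul, div_mul_cancel₀ _ hk0.ne', sub_smul, one_smul]
    abel
  have hpow : ∀ t : ℕ, (c ^ t • X - M ^ t * X * (M ^ t)ᵀ).PosSemidef := by
    intro t
    induction t with
    | zero => simpa using Matrix.PosSemidef.zero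
    | succ t ih =>
      have h1 := (ih.mul_mul_conjTranspose_same M).add (hstep.smul (pow_nonneg hc0 t))
      convert h1 using 1
      rw [pow_succ' M t]
      simp only [Matrix.conjTranspose_eq_transpose_of_trivial, Matrix.transpose_mul,
        Matrix.mul_sub, Matrix.sub_mul, Matrix.mul_smul, Matrix.smul_mul, smul_sub, smul_smul,
        pow_succ, Matrix.mul_assoc]
      abel
  -- s‖Mᵗ‖² ≤ s tr(Mᵗ(Mᵗ)ᵀ) ≤ tr(Mᵗ X (Mᵗ)ᵀ) ≤ cᵗ tr X.
  have hnorm : ∀ t : ℕ, ‖M ^ t‖ ^ 2 ≤ c ^ t * (X.trace / s) := by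
    intro t
    have h1 := (hpow t).add (hXs.mul_mul_conjTranspose_same (M ^ t))
    have h2 := h1.trace_nonneg
    have h3 := norm_sq_le_trace (M ^ t)
    simp only [Matrix.conjTranspose_eq_transpose_of_trivial, Matrix.mul_sub, Matrix.sub_mul,
      Matrix.mul_smul, Matrix.smul_mul, Matrix.mul_one, Matrix.trace_sub, Matrix.trace_add,
      Matrix.trace_smul, smul_eq_mul] at h2
    rw [mul_div_assoc', le_div_iff₀ hs]
    nlinarith
  refine isSchurStable_of_tendsto (tendsto_zero_iff_norm_tendsto_zero.2 ?_)
  have h1 : Tendsto (fun t : ℕ => √(c ^ t * (X.trace / s))) atTop (𝓝 0) := by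
    have := ((tendsto_pow_atTop_nhds_zero_of_lt_one hc0 hc1).mul_const (X.trace / s)).sqrt
    simpa using this
  exact squeeze_zero (fun t => norm_nonneg _) (fun t => Real.le_sqrt_of_sq_le (hnorm t)) h1

end PosSemidef

/-! ### Spectral and Frobenius norms of parameters -/

section Param

variable {m n : ℕ}

/-- `Param.mat` as a continuous linear map. -/
def Param.matCLM : Param m n →L[ℝ] Matrix (Fin m) (Fin n) ℝ :=
  LinearMap.toContinuousLinearMap
    { toFun := Param.mat
      map_add' := fun _ _ => rfl
      map_smul' := fun _ _ => rfl }

theorem Param.matCLM_apply (W : Param m n) : Param.matCLM W = W.mat := rfl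

theorem Param.mat_apply (W : Param m n) (k : Fin m) (l : Fin n) : W.mat k l = W (k, l) := rfl

theorem Param.spec_eq (W : Param m n) : W.spec = ‖W.mat‖ := rfl

theorem Param.spec_nonneg (W : Param m n) : 0 ≤ W.spec := norm_nonneg _

theorem Param.mat_sub (W U : Param m n) : (W - U).mat = W.mat - U.mat := rfl

theorem Param.spec_zero : (0 : Param m n).spec = 0 := by
  rw [Param.spec_eq, ← Param.matCLM_apply, map_zero, norm_zero]

theorem Param.spec_smul (c : ℝ) (W : Param m n) : (c • W).spec = |c| * W.spec := by
  rw [Param.spec_eq, ← Param.matCLM_apply, map_smul, norm_smul]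
  rfl

theorem Param.spec_add_le (W U : Param m n) : (W + U).spec ≤ W.spec + U.spec := by
  simp only [Param.spec_eq, ← Param.matCLM_apply, map_add]
  exact norm_add_le _ _

theorem Param.spec_neg (W : Param m n) : (-W).spec = W.spec := by
  simp only [Param.spec_eq, ← Param.matCLM_apply, map_neg, norm_neg]

theorem Param.continuous_spec : Continuous (Param.spec (m := m) (n := n)) :=
  (continuous_norm.comp (Param.matCLM (m := m) (n := n)).continuous :)

theorem Param.trace_mul_transpose (W : Param m n) : (W.mat * W.matᵀ).trace = ‖W‖ ^ 2 := by
  rw [EuclideanSpace.real_norm_sq_eq, Fintype.sum_prod_type]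
  simp [Matrix.trace, Matrix.mul_apply, Param.mat_apply, sq]

theorem Param.spec_le_norm (W : Param m n) : W.spec ≤ ‖W‖ := by
  refine abs_le_of_sq_le_sq' ?_ (norm_nonneg _) |>.2
  rw [← Param.trace_mul_transpose]
  exact norm_sq_le_trace W.mat

theorem Param.mat_injective : Function.Injective (Param.mat (m := m) (n := n)) := fun W U h => by
  ext ⟨k, l⟩
  exact congrFun (congrFun h k) l

variable (m n) in
/-- The Frobenius norm is bounded by a multiple of the maximum singular value. -/
theorem Param.exists_norm_le_spec : ∃ κ : ℝ, 1 ≤ κ ∧ ∀ W : Param m n, ‖W‖ ≤ κ * W.spec := by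
  obtain ⟨K, -, hK⟩ := LinearMap.exists_antilipschitzWith
    (Param.matCLM (m := m) (n := n)).toLinearMap (LinearMap.ker_eq_bot.2 Param.mat_injective)
  refine ⟨max 1 K, le_max_left _ _, fun W => ?_⟩
  have := hK.le_mul_dist W 0
  simp only [dist_zero_right, map_zero] at this
  exact this.trans (mul_le_mul_of_nonneg_right (le_max_right _ _) (norm_nonneg _))

theorem Param.spec_pos {W : Param m n} (hW : W ≠ 0) : 0 < W.spec := by
  obtain ⟨κ, hκ, h⟩ := Param.exists_norm_le_spec m n
  have h1 := (norm_pos_iff.2 hW).trans_le (h W)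
  exact pos_of_mul_pos_right h1 (by linarith)

end Param

/-! ### The state covariance and the closed form of the cost -/

namespace Tasks

variable {n m : ℕ} {ι : Type} [Fintype ι] (T : Tasks n m ι)

theorem continuous_closedLoop : Continuous T.closedLoop := by
  have : Continuous fun W : Param m n => T.A - T.B * Param.matCLM W := by fun_prop
  exact this

theorem contDiff_closedLoop {k : WithTop ℕ∞} : ContDiff ℝ k T.closedLoop := by
  let f : Matrix (Fin m) (Fin n) ℝ →L[ℝ] Matrix (Fin n) (Fin n) ℝ :=
    LinearMap.toContinuousLinearMap
      { toFun := fun X => T.B * X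
        map_add' := fun _ _ => Matrix.mul_add _ _ _
        map_smul' := fun _ _ => Matrix.mul_smul _ _ _ }
  have : ContDiff ℝ k fun W : Param m n => T.A - f (Param.matCLM W) := by fun_prop
  exact this

theorem isOpen_stab : IsOpen T.stab := isOpen_isSchurStable.preimage T.continuous_closedLoop

theorem state_eq (W : Param m n) (x : Fin n → ℝ) (t : ℕ) :
    T.state W x t = (T.closedLoop W ^ t) *ᵥ x := by
  induction t with
  | zero => simp [state]
  | succ t ih =>
    rw [state, ih, pow_succ', ← Matrix.mulVec_mulVec, closedLoop, Matrix.sub_mulVec,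
      Matrix.mulVec_neg, ← sub_eq_add_neg, Matrix.mulVec_mulVec _ T.B]

/-- The second moment matrix of the initial state. -/
def moment : Matrix (Fin n) (Fin n) ℝ := Matrix.of fun k l => ∫ x, x k * x l ∂T.D

theorem integrable_mul (k l : Fin n) : Integrable (fun x : Fin n → ℝ => x k * x l) T.D := by
  refine T.moment_D.mono' (by fun_prop) (Eventually.of_forall fun x => ?_)
  have h1 : ∀ j, x j ^ 2 ≤ x ⬝ᵥ x := fun j => by
    rw [sq]
    exact Finset.single_le_sum (f := fun j => x j * x j) (fun j _ => mul_self_nonneg _)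
      (Finset.mem_univ j)
  rw [norm_mul, Real.norm_eq_abs, Real.norm_eq_abs]
  nlinarith [h1 k, h1 l, sq_nonneg (|x k| - |x l|), sq_abs (x k), sq_abs (x l)]

/-- A linear functional is a finite combination of the entries x_k x_l, each integrable by the
second moment assumption. -/
theorem integral_linear (f : Matrix (Fin n) (Fin n) ℝ →ₗ[ℝ] ℝ) :
    ∫ x, f (Matrix.vecMulVec x x) ∂T.D = f T.moment := by
  have h : ∀ X : Matrix (Fin n) (Fin n) ℝ,
      f X = ∑ k, ∑ l, X k l * f (Matrix.single k l 1) := fun X => by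
    conv_lhs => rw [Matrix.matrix_eq_sum_single X]
    simp only [map_sum]
    refine Finset.sum_congr rfl fun k _ => Finset.sum_congr rfl fun l _ => ?_
    rw [← smul_eq_mul, ← map_smul, Matrix.smul_single, smul_eq_mul, mul_one]
  rw [h T.moment]
  simp only [h (Matrix.vecMulVec _ _), Matrix.vecMulVec_apply]
  rw [integral_finsetSum _ fun k _ => integrable_finsetSum _ fun l _ =>
    (T.integrable_mul k l).mul_const _]
  refine Finset.sum_congr rfl fun k _ => ?_
  rw [integral_finsetSum _ fun l _ => (T.integrable_mul k l).mul_const _]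
  exact Finset.sum_congr rfl fun l _ => integral_mul_const _ _

theorem moment_posSemidef : T.moment.PosSemidef := by
  refine .of_dotProduct_mulVec_nonneg ?_ fun v => ?_
  · ext k l
    simp [moment, mul_comm]
  · let f : Matrix (Fin n) (Fin n) ℝ →ₗ[ℝ] ℝ :=
      { toFun := fun X => v ⬝ᵥ (X *ᵥ v)
        map_add' := fun X Y => by rw [Matrix.add_mulVec, dotProduct_add]
        map_smul' := fun c X => by rw [Matrix.smul_mulVec, dotProduct_smul]; rfl }
    have h : 0 ≤ f T.moment := by
      rw [← T.integral_linear f]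
      refine integral_nonneg fun x => ?_
      have := (Matrix.posSemidef_vecMulVec_self_star x).dotProduct_mulVec_nonneg v
      rwa [star_trivial, star_trivial] at this
    rwa [star_trivial]

/-- The state covariance `∑ₜ 𝔼 xₜ xₜᵀ`. -/
def cov (W : Param m n) : Matrix (Fin n) (Fin n) ℝ := lyap (T.closedLoop W) T.moment

variable {T}

theorem cov_posSemidef {W : Param m n} (hW : W ∈ T.stab) : (T.cov W).PosSemidef :=
  IsSchurStable.lyap_posSemidef hW T.moment_posSemidef

/-- For fixed x the sum over t is a linear functional of xxᵀ, because the Lyapunov solution is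
linear in its inhomogeneity. The expectation therefore passes inside by `integral_linear`, and no
exchange of integral and series is required. -/
theorem cost_eq (i : ι) {W : Param m n} (hW : W ∈ T.stab) :
    T.cost i W = ((T.Q i + W.matᵀ * T.R i * W.mat) * T.cov W).trace := by
  set N := T.Q i + W.matᵀ * T.R i * W.mat
  set M := T.closedLoop W
  let g : Matrix (Fin n) (Fin n) ℝ →L[ℝ] ℝ := LinearMap.toContinuousLinearMap
    { toFun := fun X => (N * X).trace
      map_add' := fun X Y => by rw [Matrix.mul_add, Matrix.trace_add]
      map_smul' := fun c X => by rw [Matrix.mul_smul, Matrix.trace_smul]; rfl }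
  let f : Matrix (Fin n) (Fin n) ℝ →ₗ[ℝ] ℝ :=
    { toFun := fun X => g (lyap M X)
      map_add' := fun X Y => by
        rw [← map_add]
        exact congrArg g (map_add (Ring.inverse (1 - sandwich M Mᵀ)) X Y)
      map_smul' := fun c X => by
        rw [RingHom.id_apply, ← map_smul]
        exact congrArg g (map_smul (Ring.inverse (1 - sandwich M Mᵀ)) c X) }
  have h1 : ∀ x : Fin n → ℝ, ∑' t : ℕ, (T.state W x t ⬝ᵥ (N *ᵥ T.state W x t)) =
      f (Matrix.vecMulVec x x) := fun x => by
    have h2 := g.hasSum (IsSchurStable.hasSum_lyap hW (Matrix.vecMulVec x x))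
    rw [show f (Matrix.vecMulVec x x) = g (lyap M (Matrix.vecMulVec x x)) from rfl, ← h2.tsum_eq]
    refine tsum_congr fun t => ?_
    rw [T.state_eq]
    change _ = (N * (M ^ t * Matrix.vecMulVec x x * (M ^ t)ᵀ)).trace
    rw [Matrix.mul_vecMulVec, Matrix.vecMulVec_mul, Matrix.vecMul_transpose,
      Matrix.mul_vecMulVec, Matrix.trace_vecMulVec, dotProduct_comm]
  have h3 := T.integral_linear f
  exact (integral_congr_ae (.of_forall h1)).trans h3

theorem contDiffAt_cost (i : ι) {W : Param m n} (hW : W ∈ T.stab) {k : WithTop ℕ∞} :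
    ContDiffAt ℝ k (T.cost i) W := by
  have h1 : ContDiffAt ℝ k T.cov W :=
    contDiffAt_sandwichSolve (f := T.closedLoop) (g := fun W => (T.closedLoop W)ᵀ)
      T.contDiff_closedLoop.contDiffAt
      ((LinearMap.toContinuousLinearMap (Matrix.transposeLinearEquiv (Fin n) (Fin n) ℝ ℝ
        ).toLinearMap).contDiff.contDiffAt.comp W T.contDiff_closedLoop.contDiffAt)
      (IsSchurStable.summable hW) T.moment
  have h2 : ∀ a b, ContDiffAt ℝ k (fun W => T.cov W a b) W := fun a b => by
    let e : Matrix (Fin n) (Fin n) ℝ →L[ℝ] ℝ :=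
      LinearMap.toContinuousLinearMap (Matrix.entryLinearMap ℝ ℝ a b)
    exact e.contDiff.contDiffAt.comp W h1
  have h3 : ContDiffAt ℝ k
      (fun W => ((T.Q i + W.matᵀ * T.R i * W.mat) * T.cov W).trace) W := by
    simp only [Matrix.trace, Matrix.diag, Matrix.mul_apply, Matrix.add_apply,
      Matrix.transpose_apply, Param.mat_apply]
    fun_prop
  refine h3.congr_of_eventuallyEq ?_
  filter_upwards [T.isOpen_stab.mem_nhds hW] with U hU using cost_eq i hU

end Tasks

/-! ### Lower bounds for the cost, radii of stability, compact sublevel sets -/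

namespace Tasks

variable {n m : ℕ} {ι : Type} [Fintype ι] {T : Tasks n m ι}

theorem cost_nonneg (i : ι) (W : Param m n) : 0 ≤ T.cost i W := by
  refine integral_nonneg fun x => tsum_nonneg fun t => ?_
  have h : (T.Q i + W.matᵀ * T.R i * W.mat).PosSemidef :=
    (T.posDef_Q i).posSemidef.add
      (by simpa using (T.posDef_R i).posSemidef.conjTranspose_mul_mul_same W.mat)
  simpa using h.dotProduct_mulVec_nonneg (T.state W x t)

theorem mu_nonneg : 0 ≤ T.mu := sigmaMin_nonneg _

theorem moment_sub_posSemidef : (T.moment - T.mu • (1 : Matrix (Fin n) (Fin n) ℝ)).PosSemidef :=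
  posSemidef_sub_sigmaMin T.moment_posSemidef

theorem cov_sub_posSemidef {W : Param m n} (hW : W ∈ T.stab) :
    (T.cov W - T.mu • (1 : Matrix (Fin n) (Fin n) ℝ)).PosSemidef := by
  have := (IsSchurStable.lyap_sub_posSemidef hW T.moment_posSemidef).add T.moment_sub_posSemidef
  rwa [sub_add_sub_cancel] at this

theorem trace_control_nonneg (i : ι) {W : Param m n} (hW : W ∈ T.stab) :
    0 ≤ (W.matᵀ * T.R i * W.mat * T.cov W).trace :=
  trace_mul_nonneg (by simpa using (T.posDef_R i).posSemidef.conjTranspose_mul_mul_same W.mat)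
    (cov_posSemidef hW)

theorem cost_ge_trace (i : ι) {W : Param m n} (hW : W ∈ T.stab) :
    sigmaMin (T.Q i) * (T.cov W).trace ≤ T.cost i W := by
  have h1 := le_trace_mul (posSemidef_sub_sigmaMin (T.posDef_Q i).posSemidef) (cov_posSemidef hW)
  have h2 := trace_control_nonneg i hW
  rw [cost_eq i hW, Matrix.add_mul, Matrix.trace_add]
  linarith

theorem cost_ge_norm_cov (i : ι) {W : Param m n} (hW : W ∈ T.stab) :
    sigmaMin (T.Q i) * ‖T.cov W‖ ≤ T.cost i W :=
  (mul_le_mul_of_nonneg_left (norm_le_trace (cov_posSemidef hW)) (sigmaMin_nonneg _)).trans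
    (cost_ge_trace i hW)

/-- A single diagonal entry of the covariance is already at least μ; in dimension zero μ is 0 by the
convention for empty infima. The bound makes the ratio μσ_min(Q_i)/C_i(W) at most 1. -/
theorem cost_ge_mu (i : ι) {W : Param m n} (hW : W ∈ T.stab) :
    sigmaMin (T.Q i) * T.mu ≤ T.cost i W := by
  rcases Nat.eq_zero_or_pos n with rfl | hn
  · have : T.mu = 0 := by
      unfold mu sigmaMin
      have : IsEmpty (Metric.sphere (0 : EuclideanSpace ℝ (Fin 0)) 1) :=
        ⟨fun x => by simpa [Subsingleton.elim x.1 0] using x.2⟩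
      exact Real.iInf_of_isEmpty _
    rw [this, mul_zero]
    exact cost_nonneg i W
  · refine (mul_le_mul_of_nonneg_left ?_ (sigmaMin_nonneg _)).trans (cost_ge_trace i hW)
    have h1 := (cov_sub_posSemidef hW).diag_nonneg (i := ⟨0, hn⟩)
    have h2 : (T.cov W) ⟨0, hn⟩ ⟨0, hn⟩ ≤ (T.cov W).trace :=
      Finset.single_le_sum (f := fun j => T.cov W j j)
        (fun j _ => (cov_posSemidef hW).diag_nonneg) (Finset.mem_univ _)
    simp only [Matrix.sub_apply, Matrix.smul_apply, Matrix.one_apply_eq, smul_eq_mul,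
      mul_one] at h1
    linarith

/-- The cost is coercive on the set of stabilizing parameters. -/
theorem exists_cost_ge_norm_sq (T : Tasks n m ι) (i : ι) (hmu : 0 < T.mu) :
    ∃ c : ℝ, 0 < c ∧ ∀ W ∈ T.stab, c * ‖W‖ ^ 2 ≤ T.cost i W := by
  obtain ⟨s, hs, hR⟩ := exists_posSemidef_sub_of_posDef (T.posDef_R i)
  refine ⟨s * T.mu, by positivity, fun W hW => ?_⟩
  -- C_i ≥ tr(WᵀRWX) = tr(R WXWᵀ) ≥ s tr(WXWᵀ) ≥ sμ‖W‖².
  have hX := (cov_posSemidef hW).mul_mul_conjTranspose_same W.mat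
  have h1 := le_trace_mul hR hX
  have h2 := ((cov_sub_posSemidef hW).mul_mul_conjTranspose_same W.mat).trace_nonneg
  have h3 := trace_mul_nonneg (T.posDef_Q i).posSemidef (cov_posSemidef hW)
  simp only [Matrix.conjTranspose_eq_transpose_of_trivial] at h1 h2
  rw [Matrix.mul_sub, Matrix.sub_mul, Matrix.mul_smul, Matrix.smul_mul, Matrix.mul_one,
    Matrix.trace_sub, Matrix.trace_smul, W.trace_mul_transpose, smul_eq_mul] at h2
  have h4 : (T.R i * (W.mat * T.cov W * W.matᵀ)).trace =
      (W.matᵀ * T.R i * W.mat * T.cov W).trace := by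
    rw [← Matrix.mul_assoc, Matrix.trace_mul_comm]
    simp only [Matrix.mul_assoc]
  rw [cost_eq i hW, Matrix.add_mul, Matrix.trace_add, ← h4]
  nlinarith

/-- A perturbation of a stabilizing parameter that is small relative to the cost stabilizes. -/
theorem mem_stab_of_perturbation (i : ι) {W U : Param m n} (hW : W ∈ T.stab) {d : ℝ}
    (hσ : 0 < sigmaMin (T.Q i)) (hμ : 0 < T.mu)
    (hd : specNorm T.B * (U - W).spec ≤ d)
    (h : 2 * specNorm (T.closedLoop W) * d + d ^ 2 < T.mu * sigmaMin (T.Q i) / T.cost i W) :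
    U ∈ T.stab := by
  set X := T.cov W with hXdef
  set N := T.closedLoop W with hN
  set D := T.B * (U - W).mat with hD
  have hM : T.closedLoop U = N - D := by
    rw [hN, hD, closedLoop, closedLoop, Param.mat_sub, Matrix.mul_sub]
    abel
  have hDd : ‖D‖ ≤ d := (Matrix.l2_opNorm_mul _ _).trans hd
  have hd0 : 0 ≤ d := (norm_nonneg _).trans hDd
  have hC : 0 < T.cost i W := lt_of_lt_of_le (by positivity) (cost_ge_mu i hW)
  have hXp := cov_posSemidef hW
  have hXt : Xᵀ = X := by simpa using hXp.isHermitian.eq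
  -- X is tested as a certificate for U: (N - D)X(N - D)ᵀ = NXNᵀ + E = X - Σ + E with Σ ≥ μI, so ‖E‖
  -- < μ suffices. The norm of X inside E is controlled by the cost.
  set E := D * X * Dᵀ - D * X * Nᵀ - N * X * Dᵀ with hE
  have hEh : E.IsHermitian := by
    rw [Matrix.IsHermitian, Matrix.conjTranspose_eq_transpose_of_trivial, hE]
    simp only [Matrix.transpose_sub, Matrix.transpose_mul, Matrix.transpose_transpose, hXt,
      Matrix.mul_assoc]
    abel
  have hEn : ‖E‖ ≤ ‖X‖ * (2 * ‖N‖ * d + d ^ 2) := by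
    have key : ∀ F G : Matrix (Fin n) (Fin n) ℝ, ‖F * X * Gᵀ‖ ≤ ‖F‖ * ‖X‖ * ‖G‖ := fun F G => by
      rw [← norm_transpose G]
      exact (norm_mul_le _ _).trans (mul_le_mul_of_nonneg_right (norm_mul_le _ _) (norm_nonneg _))
    have h1 := norm_sub_le (D * X * Dᵀ - D * X * Nᵀ) (N * X * Dᵀ)
    have h2 := norm_sub_le (D * X * Dᵀ) (D * X * Nᵀ)
    have hX0 := norm_nonneg X
    have hN0 := norm_nonneg N
    have hD0 := norm_nonneg D
    have e1 : ‖D‖ * ‖X‖ * ‖D‖ ≤ d * ‖X‖ * d := by gcongr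
    have e2 : ‖D‖ * ‖X‖ * ‖N‖ ≤ d * ‖X‖ * ‖N‖ := by gcongr
    have e3 : ‖N‖ * ‖X‖ * ‖D‖ ≤ ‖N‖ * ‖X‖ * d := by gcongr
    calc ‖E‖ ≤ d * ‖X‖ * d + d * ‖X‖ * ‖N‖ + ‖N‖ * ‖X‖ * d := by
          linarith [key D D, key D N, key N D]
      _ = _ := by ring
  have hlt : ‖E‖ < T.mu := by
    have h1 := cost_ge_norm_cov i hW
    rw [lt_div_iff₀ hC] at h
    have h0 : 0 ≤ 2 * ‖N‖ * d + d ^ 2 := by positivity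
    have h3 : sigmaMin (T.Q i) * ‖E‖ < sigmaMin (T.Q i) * T.mu := by
      calc sigmaMin (T.Q i) * ‖E‖ ≤ sigmaMin (T.Q i) * (‖X‖ * (2 * ‖N‖ * d + d ^ 2)) := by gcongr
        _ = (sigmaMin (T.Q i) * ‖X‖) * (2 * ‖N‖ * d + d ^ 2) := by ring
        _ ≤ T.cost i W * (2 * ‖N‖ * d + d ^ 2) := by gcongr
        _ < _ := by
          rw [mul_comm]
          exact h.trans_eq (mul_comm _ _)
    exact lt_of_mul_lt_mul_left h3 hσ.le
  have hly : N * X * Nᵀ = X - T.moment := IsSchurStable.lyap_eq hW T.moment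
  change IsSchurStable (T.closedLoop U)
  refine isSchurStable_of_certificate hμ (sub_pos.2 hlt) hXp (cov_sub_posSemidef hW) ?_
  have := T.moment_sub_posSemidef.add (posSemidef_smul_one_sub hEh le_rfl)
  convert this using 1
  have h5 : (N - D) * X * (N - D)ᵀ = N * X * Nᵀ + E := by
    rw [hE]
    simp only [Matrix.transpose_sub, Matrix.sub_mul, Matrix.mul_sub]
    abel
  rw [hM, h5, hly, sub_smul]
  abel

/-- Positivity of all quantities that enter a positive `δ_i(W)`. -/
structure Regular (T : Tasks n m ι) (i : ι) : Prop where
  sigma_pos : 0 < sigmaMin (T.Q i)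
  mu_pos : 0 < T.mu
  B_pos : 0 < specNorm T.B

theorem delta_nonneg (i : ι) (W : Param m n) : 0 ≤ T.delta i W := by
  have h1 := sigmaMin_nonneg (T.Q i)
  have h2 := mu_nonneg (T := T)
  have h3 := cost_nonneg (T := T) i W
  have h4 : 0 ≤ specNorm T.B := norm_nonneg _
  have h5 : 0 ≤ specNorm (T.closedLoop W) := norm_nonneg _
  unfold delta
  positivity

/-- The three quantities are factors of the numerator or the denominator, and division by zero gives
zero. They do not depend on W, so one parameter is enough. -/
theorem regular_of_delta_pos {i : ι} {W : Param m n} (h : 0 < T.delta i W) : T.Regular i := by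
  have h1 := sigmaMin_nonneg (T.Q i)
  have h2 := mu_nonneg (T := T)
  have h4 : 0 ≤ specNorm T.B := norm_nonneg _
  refine ⟨h1.lt_of_ne' fun h0 => ?_, h2.lt_of_ne' fun h0 => ?_, h4.lt_of_ne' fun h0 => ?_⟩ <;>
  simp [delta, h0] at h

theorem delta_eq_zero_of_not_regular {i : ι} (h : ¬ T.Regular i) (W : Param m n) :
    T.delta i W = 0 :=
  le_antisymm (not_lt.1 fun h' => h (regular_of_delta_pos h')) (delta_nonneg i W)

namespace Regular

variable {i : ι}

theorem cost_pos (hr : T.Regular i) {W : Param m n} (hW : W ∈ T.stab) : 0 < T.cost i W :=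
  lt_of_lt_of_le (mul_pos hr.sigma_pos hr.mu_pos) (cost_ge_mu i hW)

theorem delta_pos (hr : T.Regular i) {W : Param m n} (hW : W ∈ T.stab) : 0 < T.delta i W := by
  have h1 := hr.sigma_pos
  have h2 := hr.mu_pos
  have h3 := hr.cost_pos hW
  have h4 := hr.B_pos
  have h5 : 0 ≤ specNorm (T.closedLoop W) := norm_nonneg _
  unfold delta
  positivity

theorem specNorm_mul_delta (hr : T.Regular i) {W : Param m n} (hW : W ∈ T.stab) :
    specNorm T.B * T.delta i W =
      T.mu * sigmaMin (T.Q i) / T.cost i W / (4 * (specNorm (T.closedLoop W) + 1)) := by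
  have h3 := (hr.cost_pos hW).ne'
  have h4 := hr.B_pos.ne'
  have h5 : specNorm (T.closedLoop W) + 1 ≠ 0 := by
    have : 0 ≤ specNorm (T.closedLoop W) := norm_nonneg _
    positivity
  unfold delta
  field_simp

theorem ratio_le_one (hr : T.Regular i) {W : Param m n} (hW : W ∈ T.stab) :
    T.mu * sigmaMin (T.Q i) / T.cost i W ≤ 1 := by
  rw [div_le_one (hr.cost_pos hW), mul_comm]
  exact cost_ge_mu i hW

theorem specNorm_mul_delta_le (hr : T.Regular i) {W : Param m n} (hW : W ∈ T.stab) :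
    specNorm T.B * T.delta i W ≤ 1 / 4 := by
  have h5 : 0 ≤ specNorm (T.closedLoop W) := norm_nonneg _
  rw [hr.specNorm_mul_delta hW, div_le_iff₀ (by positivity)]
  linarith [hr.ratio_le_one hW]

/-- With x = ‖A - BW‖ and y = μσ_min(Q_i)/C_i(W) ≤ 1, the choice of δ_i gives d = ‖B‖δ_i = y/(4(x +
1)) ≤ 1/4, and then 2xd + d² < 4(x + 1)d = y. -/
theorem mem_stab_of_spec_le_delta (hr : T.Regular i) {W U : Param m n} (hW : W ∈ T.stab)
    (h : (U - W).spec ≤ T.delta i W) : U ∈ T.stab := by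
  refine mem_stab_of_perturbation i hW hr.sigma_pos hr.mu_pos
    (mul_le_mul_of_nonneg_left h hr.B_pos.le) ?_
  rw [hr.specNorm_mul_delta hW]
  have hx : 0 ≤ specNorm (T.closedLoop W) := norm_nonneg _
  have hy1 := hr.ratio_le_one hW
  have hy0 : 0 < T.mu * sigmaMin (T.Q i) / T.cost i W :=
    div_pos (mul_pos hr.mu_pos hr.sigma_pos) (hr.cost_pos hW)
  set y := T.mu * sigmaMin (T.Q i) / T.cost i W
  set x := specNorm (T.closedLoop W)
  have hd : y / (4 * (x + 1)) * (4 * (x + 1)) = y := div_mul_cancel₀ _ (by positivity)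
  have hd0 : 0 < y / (4 * (x + 1)) := by positivity
  set d := y / (4 * (x + 1))
  have hdx : 0 ≤ d * x := by positivity
  nlinarith

/-- The perturbation condition is (x + ‖B‖s)² < x² + y with s = ‖U - W‖, and δ̄_i is its solution
for s. -/
theorem mem_stab_of_spec_lt_deltaBar (hr : T.Regular i) {W U : Param m n} (hW : W ∈ T.stab)
    (h : (U - W).spec < T.deltaBar i W) : U ∈ T.stab := by
  refine mem_stab_of_perturbation i hW hr.sigma_pos hr.mu_pos le_rfl ?_
  have hx : 0 ≤ specNorm (T.closedLoop W) := norm_nonneg _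
  have hy0 : 0 < T.mu * sigmaMin (T.Q i) / T.cost i W :=
    div_pos (mul_pos hr.mu_pos hr.sigma_pos) (hr.cost_pos hW)
  rw [deltaBar, lt_div_iff₀ hr.B_pos, lt_sub_iff_add_lt, Real.lt_sqrt (by
    have := (U - W).spec_nonneg
    have := hr.B_pos
    positivity)] at h
  nlinarith

end Regular

theorem mem_stab_of_spec_le_delta {i : ι} {W U : Param m n} (hW : W ∈ T.stab)
    (h : (U - W).spec ≤ T.delta i W) : U ∈ T.stab := by
  by_cases hr : T.Regular i
  · exact hr.mem_stab_of_spec_le_delta hW h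
  · rw [delta_eq_zero_of_not_regular hr] at h
    have : U - W = 0 := by
      by_contra h0
      exact absurd h (not_le.2 (Param.spec_pos h0))
    rwa [sub_eq_zero.1 this]

theorem continuousAt_cost (i : ι) {W : Param m n} (hW : W ∈ T.stab) :
    ContinuousAt (T.cost i) W :=
  (contDiffAt_cost i hW (k := 0)).continuousAt

theorem continuousOn_delta (i : ι) : ContinuousOn (T.delta i) T.stab := by
  by_cases hr : T.Regular i
  · intro W hW
    have h1 : Continuous fun W => specNorm (T.closedLoop W) :=
      (continuous_norm.comp T.continuous_closedLoop :)
    have h2 := continuousAt_cost i hW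
    have h3 := hr.cost_pos hW
    have h4 := hr.B_pos
    have h5 : 0 ≤ specNorm (T.closedLoop W) := norm_nonneg _
    refine ContinuousAt.continuousWithinAt ?_
    unfold delta
    exact continuousAt_const.div (((continuousAt_const.mul h2).mul continuousAt_const).mul
      (h1.continuousAt.add continuousAt_const)) (by positivity)
  · rw [show T.delta i = fun _ => 0 from funext (delta_eq_zero_of_not_regular hr)]
    exact continuousOn_const

theorem specNorm_closedLoop_le (W U : Param m n) :
    specNorm (T.closedLoop U) ≤ specNorm (T.closedLoop W) + specNorm T.B * (U - W).spec := by
  have h : T.closedLoop U = T.closedLoop W - T.B * (U - W).mat := by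
    rw [closedLoop, closedLoop, Param.mat_sub, Matrix.mul_sub]
    abel
  rw [h]
  have h1 := Matrix.l2_opNorm_mul T.B (U - W).mat
  exact (norm_sub_le (T.closedLoop W) _).trans (add_le_add le_rfl h1)

/-- `δ_i` decreases slowly along steps that do not increase the cost. -/
theorem Regular.delta_sub_le {i : ι} (hr : T.Regular i) {W V : Param m n} (hW : W ∈ T.stab)
    (hV : V ∈ T.stab) (hcost : T.cost i V ≤ T.cost i W) :
    T.delta i W - (V - W).spec ≤ T.delta i V := by
  have hx : 0 ≤ specNorm (T.closedLoop W) := norm_nonneg _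
  have hx' : 0 ≤ specNorm (T.closedLoop V) := norm_nonneg _
  have hxx := specNorm_closedLoop_le (T := T) W V
  have hB := hr.B_pos
  have hσ := mul_pos hr.sigma_pos hr.mu_pos
  have hCW := hr.cost_pos hW
  have hCV := hr.cost_pos hV
  have hs := (V - W).spec_nonneg
  have hq := hr.specNorm_mul_delta_le hW
  have h1 : T.delta i W * (4 * T.cost i W * specNorm T.B * (specNorm (T.closedLoop W) + 1)) =
      sigmaMin (T.Q i) * T.mu := div_mul_cancel₀ _ (by positivity)
  set x := specNorm (T.closedLoop W)
  set x' := specNorm (T.closedLoop V)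
  set s := (V - W).spec
  set B := specNorm T.B
  set δ := T.delta i W
  have hδ : 0 ≤ δ := delta_nonneg i W
  rcases le_total (δ - s) 0 with h0 | h0
  · exact h0.trans (delta_nonneg i V)
  unfold delta
  rw [le_div_iff₀ (by positivity), ← h1]
  -- The factor x + 1 grows by at most Bs while δ drops by s; since Bδ ≤ 1/4, the loss outweighs the
  -- gain.
  have key : (δ - s) * (x' + 1) ≤ δ * (x + 1) := by
    have : (δ - s) * (x' + 1) ≤ (δ - s) * (x + B * s + 1) := by gcongr
    have : (B * δ) * s ≤ 1 / 4 * s := by gcongr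
    nlinarith [mul_nonneg hs hx, mul_nonneg hB.le (mul_nonneg hs hs)]
  calc (δ - s) * (4 * T.cost i V * B * (x' + 1))
      = (4 * T.cost i V * B) * ((δ - s) * (x' + 1)) := by ring
    _ ≤ (4 * T.cost i W * B) * (δ * (x + 1)) := by gcongr
    _ = _ := by ring

/-- Sublevel sets of the cost are compact subsets of the stabilizing set. -/
theorem Regular.isCompact_sublevel {i : ι} (hr : T.Regular i) (c : ℝ) :
    IsCompact {W | W ∈ T.stab ∧ T.cost i W ≤ c} := by
  obtain ⟨a, ha, hcoer⟩ := exists_cost_ge_norm_sq T i hr.mu_pos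
  set S := {W | W ∈ T.stab ∧ T.cost i W ≤ c} with hS
  have hbound : ∀ W ∈ S, ‖W‖ ≤ √(c / a) := fun W hW => by
    refine Real.le_sqrt_of_sq_le ?_
    rw [le_div_iff₀ ha, mul_comm]
    exact (hcoer W hW.1).trans hW.2
  have hB := hr.B_pos
  refine Metric.isCompact_of_isClosed_isBounded ?_
    (isBounded_iff_forall_norm_le.2 ⟨_, hbound⟩)
  refine isClosed_of_closure_subset fun V hV => ?_
  set x := specNorm (T.closedLoop 0) + specNorm T.B * √(c / a) with hx
  have hx0 : 0 ≤ x := add_nonneg (norm_nonneg _) (by positivity)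
  obtain ⟨W₀, hW₀⟩ : S.Nonempty := closure_nonempty_iff.1 ⟨V, hV⟩
  have hc : 0 < c := (hr.cost_pos hW₀.1).trans_le hW₀.2
  have hσ := mul_pos hr.sigma_pos hr.mu_pos
  -- r bounds δ_i from below on all of S, so every limit point of S lies in a stability ball around
  -- a member of S and cannot leave 𝒮.
  set r := sigmaMin (T.Q i) * T.mu / (4 * c * specNorm T.B * (x + 1)) with hrdef
  have hr0 : 0 < r := by positivity
  have hVs : V ∈ T.stab := by
    obtain ⟨W, hW, hd⟩ := Metric.mem_closure_iff.1 hV r hr0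
    refine hr.mem_stab_of_spec_le_delta hW.1 ?_
    have h1 : (V - W).spec ≤ r :=
      ((V - W).spec_le_norm.trans_eq (dist_eq_norm V W).symm).trans hd.le
    refine h1.trans ?_
    have h2 : specNorm (T.closedLoop W) ≤ x := by
      refine (specNorm_closedLoop_le 0 W).trans ?_
      rw [sub_zero]
      exact add_le_add le_rfl
        (mul_le_mul_of_nonneg_left (W.spec_le_norm.trans (hbound W hW)) hB.le)
    have h3 : 0 ≤ specNorm (T.closedLoop W) := norm_nonneg _
    have h4 := hr.cost_pos hW.1
    have h5 := hW.2
    rw [hrdef, delta]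
    gcongr
  refine ⟨hVs, ?_⟩
  by_contra! hlt
  have hev := (continuousAt_cost i hVs).eventually (lt_mem_nhds hlt)
  obtain ⟨W, hW1, hW2⟩ := mem_closure_iff_nhds.1 hV _ hev
  exact absurd hW2.2 (not_le.2 hW1)

/-- The union of the closed spectral-norm balls of radius `δ_i(W)` around `W ∈ K`. -/
def tube (T : Tasks n m ι) (i : ι) (K : Set (Param m n)) : Set (Param m n) :=
  (fun q : Param m n × Param m n => q.1 + T.delta i q.1 • q.2) ''
    (K ×ˢ {Z : Param m n | Z.spec ≤ 1})

theorem isCompact_tube (i : ι) {K : Set (Param m n)} (hK : IsCompact K) (hKs : K ⊆ T.stab) :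
    IsCompact (T.tube i K) := by
  obtain ⟨κ, hκ, h⟩ := Param.exists_norm_le_spec m n
  have h1 : IsCompact {Z : Param m n | Z.spec ≤ 1} := by
    refine Metric.isCompact_of_isClosed_isBounded
      (isClosed_le Param.continuous_spec continuous_const)
      (isBounded_iff_forall_norm_le.2 ⟨κ, fun Z hZ => (h Z).trans ?_⟩)
    have : κ * Z.spec ≤ κ * 1 := mul_le_mul_of_nonneg_left hZ (by linarith)
    linarith
  refine (hK.prod h1).image_of_continuousOn ?_
  have h2 : ContinuousOn (fun q : Param m n × Param m n => T.delta i q.1)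
      (K ×ˢ {Z : Param m n | Z.spec ≤ 1}) :=
    (continuousOn_delta i).comp continuousOn_fst fun q hq => hKs hq.1
  exact continuousOn_fst.add (h2.fun_smul continuousOn_snd)

theorem mem_tube_of_spec_le {i : ι} {K : Set (Param m n)} {W U : Param m n} (hW : W ∈ K)
    (h : (U - W).spec ≤ T.delta i W) : U ∈ T.tube i K := by
  rcases (delta_nonneg (T := T) i W).eq_or_lt with h0 | h0
  · have : U - W = 0 := by
      by_contra h1
      exact absurd h (not_le.2 (h0 ▸ Param.spec_pos h1))
    refine ⟨(W, 0), ⟨hW, ?_⟩, ?_⟩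
    · simp [Param.spec_zero]
    · simp [sub_eq_zero.1 this]
  · refine ⟨(W, (T.delta i W)⁻¹ • (U - W)), ⟨hW, ?_⟩, ?_⟩
    · change ((T.delta i W)⁻¹ • (U - W)).spec ≤ 1
      rw [Param.spec_smul, abs_of_pos (inv_pos.2 h0), inv_mul_le_one₀ h0]
      exact h
    · simp [smul_smul, mul_inv_cancel₀ h0.ne']

theorem tube_subset_stab (i : ι) {K : Set (Param m n)} (hKs : K ⊆ T.stab) :
    T.tube i K ⊆ T.stab := by
  rintro _ ⟨⟨W, Z⟩, ⟨hW, hZ⟩, rfl⟩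
  refine mem_stab_of_spec_le_delta (i := i) (hKs hW) ?_
  have h0 := delta_nonneg (T := T) i W
  have h1 : Z.spec ≤ 1 := hZ
  change (W + T.delta i W • Z - W).spec ≤ T.delta i W
  rw [add_sub_cancel_left, Param.spec_smul, abs_of_nonneg h0]
  exact mul_le_of_le_one_right h0 h1

end Tasks

/-! ### The descent lemma -/

section Descent

variable {E : Type*} [NormedAddCommGroup E] [InnerProductSpace ℝ E] [CompleteSpace E]

/-- The descent inequality along a segment on which the gradient varies at most linearly. -/
theorem descent_along_segment {f : E → ℝ} {x d : E} {K : ℝ}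
    (hf : ∀ t ∈ Set.Icc (0 : ℝ) 1, DifferentiableAt ℝ f (x + t • d))
    (hK : ∀ t ∈ Set.Icc (0 : ℝ) 1,
      ‖gradient f (x + t • d) - gradient f x‖ ≤ K * ‖t • d‖) :
    f (x + d) ≤ f x + ⟪gradient f x, d⟫ + K / 2 * ‖d‖ ^ 2 := by
  -- φ is nonincreasing. Its derivative compares gradients only with the base point x, which is all
  -- that the local constants provide.
  let φ : ℝ → ℝ := fun t => f (x + t • d) - t * ⟪gradient f x, d⟫ - K / 2 * t ^ 2 * ‖d‖ ^ 2
  have hφ : ∀ t ∈ Set.Icc (0 : ℝ) 1, HasDerivAt φ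
      (⟪gradient f (x + t • d), d⟫ - ⟪gradient f x, d⟫ - K * t * ‖d‖ ^ 2) t := fun t ht => by
    have h1 : HasDerivAt (fun t : ℝ => x + t • d) d t := by
      simpa using ((hasDerivAt_id t).smul_const d).const_add x
    have h2 := (hf t ht).hasGradientAt.hasFDerivAt.comp_hasDerivAt t h1
    have h3 := (h2.sub ((hasDerivAt_id t).mul_const ⟪gradient f x, d⟫)).sub
      (((hasDerivAt_pow 2 t).const_mul (K / 2)).mul_const (‖d‖ ^ 2))
    refine HasDerivAt.congr_deriv (f := φ) h3 ?_
    simp only [InnerProductSpace.toDual_apply_apply, one_mul, Nat.cast_ofNat]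
    ring
  have hanti : AntitoneOn φ (Set.Icc 0 1) := by
    refine antitoneOn_of_hasDerivWithinAt_nonpos (convex_Icc 0 1)
      (fun t ht => (hφ t ht).continuousAt.continuousWithinAt)
      (fun t ht => (hφ t (interior_subset ht)).hasDerivWithinAt) fun t ht => ?_
    have ht' := interior_subset ht
    have h1 := real_inner_le_norm (gradient f (x + t • d) - gradient f x) d
    have h2 := mul_le_mul_of_nonneg_right (hK t ht') (norm_nonneg d)
    rw [norm_smul, Real.norm_of_nonneg ht'.1] at h2
    rw [inner_sub_left] at h1
    nlinarith
  have h := hanti (Set.left_mem_Icc.2 zero_le_one) (Set.right_mem_Icc.2 zero_le_one) zero_le_one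
  simp only [φ, one_smul, zero_smul, add_zero] at h
  linarith

end Descent

/-! ### Derivatives of the cost, local Lipschitz constants, the gradient of the objective -/

namespace Tasks

variable {n m : ℕ} {ι : Type} [Fintype ι] {T : Tasks n m ι}

theorem grad_eq (i : ι) (W : Param m n) :
    T.grad i W = (InnerProductSpace.toDual ℝ (Param m n)).symm (fderiv ℝ (T.cost i) W) := rfl

theorem contDiffAt_grad (i : ι) {W : Param m n} (hW : W ∈ T.stab) {k : ℕ} :
    ContDiffAt ℝ k (T.grad i) W := by
  have h1 : ContDiffAt ℝ k (fderiv ℝ (T.cost i)) W :=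
    (contDiffAt_cost i hW (k := (k + 1 : ℕ))).fderiv_right (by norm_cast)
  exact (InnerProductSpace.toDual ℝ (Param m n)).symm.toContinuousLinearEquiv.contDiff.contDiffAt.comp
    W h1

theorem contDiffAt_hess (i : ι) {W : Param m n} (hW : W ∈ T.stab) {k : ℕ} :
    ContDiffAt ℝ k (T.hess i) W :=
  (contDiffAt_grad i hW (k := k + 1)).fderiv_right (by norm_cast)

theorem differentiableAt_cost (i : ι) {W : Param m n} (hW : W ∈ T.stab) :
    DifferentiableAt ℝ (T.cost i) W :=
  (contDiffAt_cost i hW (k := 1)).differentiableAt one_ne_zero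

theorem hasFDerivAt_grad (i : ι) {W : Param m n} (hW : W ∈ T.stab) :
    HasFDerivAt (T.grad i) (T.hess i W) W :=
  ((contDiffAt_grad i hW (k := 1)).differentiableAt (by simp)).hasFDerivAt

theorem inner_grad (i : ι) (W v : Param m n) : ⟪T.grad i W, v⟫ = fderiv ℝ (T.cost i) W v := by
  rw [grad_eq, InnerProductSpace.toDual_symm_apply]

/-- The Hessian is symmetric. -/
theorem inner_hess_comm (i : ι) {W : Param m n} (hW : W ∈ T.stab) (u v : Param m n) :
    ⟪T.hess i W u, v⟫ = ⟪u, T.hess i W v⟫ := by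
  have hd : DifferentiableAt ℝ (fderiv ℝ (T.cost i)) W :=
    ((contDiffAt_cost i hW (k := 2)).fderiv_right (m := 1) (by norm_num)).differentiableAt
      one_ne_zero
  have key : ∀ u v, ⟪T.hess i W u, v⟫ = fderiv ℝ (fderiv ℝ (T.cost i)) W u v := fun u v => by
    have h1 := ((innerSL ℝ v).hasFDerivAt (x := T.grad i W)).comp W (hasFDerivAt_grad i hW)
    have h2 := ((ContinuousLinearMap.apply ℝ ℝ v).hasFDerivAt
      (x := fderiv ℝ (T.cost i) W)).comp W hd.hasFDerivAt
    have h3 : (innerSL ℝ v) ∘ T.grad i =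
        (ContinuousLinearMap.apply ℝ ℝ v) ∘ fderiv ℝ (T.cost i) := funext fun U => by
      simp only [Function.comp_apply, innerSL_apply_apply, ContinuousLinearMap.apply_apply]
      rw [real_inner_comm, inner_grad]
    rw [h3] at h1
    rw [real_inner_comm]
    exact DFunLike.congr_fun (h1.unique h2) u
  have hsymm : IsSymmSndFDerivAt ℝ (T.cost i) W :=
    (contDiffAt_cost i hW (k := 2)).isSymmSndFDerivAt (by simp)
  rw [key, hsymm u v, ← key, real_inner_comm]

theorem convex_spec_ball (W : Param m n) (r : ℝ) : Convex ℝ {U : Param m n | (U - W).spec ≤ r} := by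
  intro U hU V hV a b ha hb hab
  have h : a • U + b • V - W = a • (U - W) + b • (V - W) := by
    rw [smul_sub, smul_sub, sub_add_sub_comm, ← add_smul, hab, one_smul]
  change (a • U + b • V - W).spec ≤ r
  rw [h]
  refine (Param.spec_add_le _ _).trans ?_
  rw [Param.spec_smul, Param.spec_smul, abs_of_nonneg ha, abs_of_nonneg hb]
  have h1 : (U - W).spec ≤ r := hU
  have h2 : (V - W).spec ≤ r := hV
  calc a * (U - W).spec + b * (V - W).spec ≤ a * r + b * r := by gcongr
    _ = r := by rw [← add_mul, hab, one_mul]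

theorem continuousOn_hess (i : ι) : ContinuousOn (T.hess i) T.stab := fun _ hW =>
  (contDiffAt_hess i hW (k := 0)).continuousAt.continuousWithinAt

theorem continuousOn_grad (i : ι) : ContinuousOn (T.grad i) T.stab := fun _ hW =>
  (contDiffAt_grad i hW (k := 0)).continuousAt.continuousWithinAt

theorem continuousOn_fderiv_hess (i : ι) : ContinuousOn (fderiv ℝ (T.hess i)) T.stab :=
  fun W hW => ((contDiffAt_hess i hW (k := 1)).fderiv_right (m := 0)
    (by norm_num)).continuousAt.continuousWithinAt

/-- Local Lipschitz constants exist. -/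
theorem exists_isLipschitz (T : Tasks n m ι) :
    ∃ ℓ ρ : ι → Param m n → ℝ, T.IsLipschitz ℓ ρ := by
  obtain ⟨κ, hκ, hspec⟩ := Param.exists_norm_le_spec m n
  have hκ0 : 0 ≤ κ := by linarith
  -- For f the norm of a derivative, this is the mean value constant on the convex ball of radius
  -- δ_i(W). The tube of a compact K is compact in 𝒮 and contains all these balls, which gives local
  -- boundedness.
  let sup : (Param m n → ℝ) → ι → Param m n → ℝ := fun f i W => sSup (f '' T.tube i {W})
  have hbdd : ∀ f : Param m n → ℝ, ContinuousOn f T.stab → ∀ i, ∀ K ⊆ T.stab, IsCompact K →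
      BddAbove (f '' T.tube i K) := fun f hf i K hK hKc =>
    ((isCompact_tube i hKc hK).image_of_continuousOn
      (hf.mono (tube_subset_stab i hK))).bddAbove
  have hle : ∀ f : Param m n → ℝ, ContinuousOn f T.stab → ∀ i, ∀ W ∈ T.stab, ∀ U : Param m n,
      (U - W).spec ≤ T.delta i W → f U ≤ sup f i W := fun f hf i W hW U hU =>
    le_csSup (hbdd f hf i {W} (Set.singleton_subset_iff.2 hW) isCompact_singleton)
      ⟨U, mem_tube_of_spec_le rfl hU, rfl⟩
  have hself : ∀ i (W : Param m n), (W - W).spec ≤ T.delta i W := fun i W => by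
    rw [sub_self, Param.spec_zero]
    exact delta_nonneg i W
  have hsup : ∀ f : Param m n → ℝ, ContinuousOn f T.stab → ∀ i, ∀ K ⊆ T.stab, IsCompact K →
      ∃ M, ∀ W ∈ K, sup f i W ≤ M := fun f hf i K hK hKc => by
    obtain ⟨M, hM⟩ := hbdd f hf i K hK hKc
    refine ⟨M, fun W hW => csSup_le ⟨_, W, mem_tube_of_spec_le rfl (hself i W), rfl⟩ ?_⟩
    rintro _ ⟨U, ⟨q, hq, rfl⟩, rfl⟩
    exact hM ⟨_, ⟨q, ⟨by rw [Set.mem_singleton_iff.1 hq.1]; exact hW, hq.2⟩, rfl⟩, rfl⟩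
  have hc1 : ∀ i, ContinuousOn (fun W => ‖T.hess i W‖) T.stab := fun i => (continuousOn_hess i).norm
  have hc2 : ∀ i, ContinuousOn (fun W => ‖fderiv ℝ (T.hess i) W‖) T.stab :=
    fun i => (continuous_norm (E := Param m n →L[ℝ] Param m n →L[ℝ] Param m n)).comp_continuousOn
      (continuousOn_fderiv_hess i)
  have hfrob : ∀ i, ∀ W ∈ T.stab, ∀ U, (U - W).spec ≤ T.delta i W →
      ‖T.grad i U - T.grad i W‖ ≤ sup (fun W => ‖T.hess i W‖) i W * ‖U - W‖ :=
    fun i W hW U hUW =>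
      (convex_spec_ball W (T.delta i W)).norm_image_sub_le_of_norm_hasFDerivWithin_le
        (fun V hV => (hasFDerivAt_grad i (mem_stab_of_spec_le_delta hW hV)).hasFDerivWithinAt)
        (fun V hV => hle _ (hc1 i) i W hW V hV) (hself i W) hUW
  have hnn : ∀ i, ∀ W ∈ T.stab, 0 ≤ sup (fun W => ‖T.hess i W‖) i W := fun i W hW =>
    (norm_nonneg _).trans (hle _ (hc1 i) i W hW W (hself i W))
  have hnn2 : ∀ i, ∀ W ∈ T.stab, 0 ≤ sup (fun W => ‖fderiv ℝ (T.hess i) W‖) i W := fun i W hW =>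
    (norm_nonneg (fderiv ℝ (T.hess i) W)).trans (hle _ (hc2 i) i W hW W (hself i W))
  -- κ pays for replacing the Frobenius norm of U - W by the spectral norm; as κ ≥ 1 it is harmless
  -- in the Frobenius inequality.
  refine ⟨fun i W => κ * sup (fun W => ‖T.hess i W‖) i W,
    fun i W => κ * sup (fun W => ‖fderiv ℝ (T.hess i) W‖) i W, ?_, ?_, ?_, ?_⟩
  · intro i W hW U _ hUW
    calc (T.grad i U - T.grad i W).spec ≤ ‖T.grad i U - T.grad i W‖ := Param.spec_le_norm _
      _ ≤ sup (fun W => ‖T.hess i W‖) i W * ‖U - W‖ := hfrob i W hW U hUW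
      _ ≤ sup (fun W => ‖T.hess i W‖) i W * (κ * (U - W).spec) :=
        mul_le_mul_of_nonneg_left (hspec _) (hnn i W hW)
      _ = _ := by ring
  · intro i W hW U _ hUW
    refine (hfrob i W hW U hUW).trans (mul_le_mul_of_nonneg_right ?_ (norm_nonneg _))
    exact le_mul_of_one_le_left (hnn i W hW) hκ
  · intro i W hW U _ hUW
    calc ‖T.hess i U - T.hess i W‖
        ≤ sup (fun W => ‖fderiv ℝ (T.hess i) W‖) i W * ‖U - W‖ :=
        (convex_spec_ball W (T.delta i W)).norm_image_sub_le_of_norm_fderiv_le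
          (fun V hV => (contDiffAt_hess i (mem_stab_of_spec_le_delta hW hV)
            (k := 1)).differentiableAt (by simp))
          (fun V hV => hle _ (hc2 i) i W hW V hV) (hself i W) hUW
      _ ≤ sup (fun W => ‖fderiv ℝ (T.hess i) W‖) i W * (κ * (U - W).spec) :=
        mul_le_mul_of_nonneg_left (hspec _) (hnn2 i W hW)
      _ = _ := by ring
  · intro i K hK hKc
    obtain ⟨M₁, h₁⟩ := hsup _ (hc1 i) i K hK hKc
    obtain ⟨M₂, h₂⟩ := hsup _ (hc2 i) i K hK hKc
    refine ⟨κ * max M₁ M₂, fun W hW => ⟨?_, ?_⟩⟩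
    · exact mul_le_mul_of_nonneg_left ((h₁ W hW).trans (le_max_left _ _)) hκ0
    · exact mul_le_mul_of_nonneg_left ((h₂ W hW).trans (le_max_right _ _)) hκ0

theorem hasFDerivAt_adapt (η : ℝ) (i : ι) {W : Param m n} (hW : W ∈ T.stab) :
    HasFDerivAt (T.adapt η i) (T.G η i W) W :=
  (hasFDerivAt_id W).sub ((hasFDerivAt_grad i hW).const_smul η)

/-- The chain rule composes the derivative of C_i with G_i; G_i is self-adjoint by symmetry of the
Hessian, so it can be moved onto the gradient. -/
theorem hasGradientAt_objective {η : ℝ} {W : Param m n} (hW : W ∈ T.mamlStab η) :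
    HasGradientAt (T.objective η)
      (∑ i, T.p i • T.G η i W (T.grad i (T.adapt η i W))) W := by
  have h1 : HasFDerivAt (T.objective η) (∑ i, T.p i •
      (fderiv ℝ (T.cost i) (T.adapt η i W)).comp (T.G η i W)) W := by
    refine HasFDerivAt.fun_sum fun i _ => HasFDerivAt.const_mul ?_ (T.p i)
    exact (differentiableAt_cost i (hW.2 i)).hasFDerivAt.comp W (hasFDerivAt_adapt η i hW.1)
  rw [hasGradientAt_iff_hasFDerivAt]
  suffices h : InnerProductSpace.toDual ℝ (Param m n)
      (∑ i, T.p i • T.G η i W (T.grad i (T.adapt η i W))) =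
      ∑ i, T.p i • (fderiv ℝ (T.cost i) (T.adapt η i W)).comp (T.G η i W) by
    rw [h]
    exact h1
  refine ContinuousLinearMap.ext fun v => ?_
  rw [InnerProductSpace.toDual_apply_apply, sum_inner]
  simp only [_root_.sum_apply, _root_.smul_apply,
    ContinuousLinearMap.comp_apply, real_inner_smul_left, smul_eq_mul]
  refine Finset.sum_congr rfl fun i _ => ?_
  rw [← inner_grad]
  congr 1
  simp only [G, _root_.sub_apply, ContinuousLinearMap.id_apply,
    _root_.smul_apply, inner_sub_left, inner_sub_right, real_inner_smul_left,
    real_inner_smul_right, inner_hess_comm i hW.1]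

theorem gradF_eq {η : ℝ} {W : Param m n} (hW : W ∈ T.mamlStab η) :
    T.gradF η W = ∑ i, T.p i • T.G η i W (T.grad i (T.adapt η i W)) :=
  (hasGradientAt_objective hW).gradient

end Tasks

/-! ### The inner step under Condition 1 -/

namespace Tasks

variable {n m : ℕ} {ι : Type} [Fintype ι] {T : Tasks n m ι}

theorem nonempty_index (T : Tasks n m ι) : Nonempty ι := by
  by_contra h
  rw [not_nonempty_iff] at h
  simpa using T.p_sum

theorem deltaMin_nonneg (W : Param m n) : 0 ≤ T.deltaMin W :=
  Real.iInf_nonneg fun i => delta_nonneg i W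

theorem deltaMin_le (i : ι) (W : Param m n) : T.deltaMin W ≤ T.delta i W :=
  ciInf_le (Set.finite_range _).bddBelow i

theorem le_iSup_index (f : ι → ℝ) (i : ι) : f i ≤ ⨆ i, f i :=
  le_ciSup (Set.finite_range f).bddAbove i

theorem Regular.exists_ne_zero {i : ι} (hr : T.Regular i) : ∃ Z : Param m n, Z ≠ 0 := by
  have hB : T.B ≠ 0 := fun h => by
    have := hr.B_pos
    rw [h, specNorm_eq_norm, norm_zero] at this
    exact lt_irrefl _ this
  obtain ⟨j, k, -⟩ : ∃ j k, T.B j k ≠ 0 := by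
    by_contra! h
    exact hB (Matrix.ext h)
  refine ⟨EuclideanSpace.single (k, j) 1, fun h => ?_⟩
  simpa using congrArg (fun Z : Param m n => Z (k, j)) h

theorem Regular.exists_perturbation {i : ι} (hr : T.Regular i) {W : Param m n}
    (hW : W ∈ T.stab) : ∃ U ∈ T.stab, U ≠ W ∧ (U - W).spec ≤ T.delta i W := by
  obtain ⟨Z, hZ⟩ := hr.exists_ne_zero
  have h1 := Param.spec_pos hZ
  have h2 := hr.delta_pos hW
  have h3 : (W + (T.delta i W / Z.spec) • Z - W).spec ≤ T.delta i W := by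
    rw [add_sub_cancel_left, Param.spec_smul, abs_of_pos (div_pos h2 h1), div_mul_cancel₀ _ h1.ne']
  refine ⟨_, hr.mem_stab_of_spec_le_delta hW h3, fun h => ?_, h3⟩
  rw [add_eq_left, smul_eq_zero] at h
  exact h.elim (div_pos h2 h1).ne' hZ

namespace IsLipschitz

variable {ℓ ρ : ι → Param m n → ℝ}

/-- The sign is forced by the inequality at some U ≠ W, which exists because δ_i(W) > 0. -/
theorem ell_nonneg (hL : T.IsLipschitz ℓ ρ) {i : ι} (hr : T.Regular i) {W : Param m n}
    (hW : W ∈ T.stab) : 0 ≤ ℓ i W := by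
  obtain ⟨U, hU, hne, hd⟩ := hr.exists_perturbation hW
  exact nonneg_of_mul_nonneg_left ((norm_nonneg _).trans (hL.grad_frob i W hW U hU hd))
    (norm_pos_iff.2 (sub_ne_zero.2 hne))

theorem rho_nonneg (hL : T.IsLipschitz ℓ ρ) {i : ι} (hr : T.Regular i) {W : Param m n}
    (hW : W ∈ T.stab) : 0 ≤ ρ i W := by
  obtain ⟨U, hU, hne, hd⟩ := hr.exists_perturbation hW
  exact nonneg_of_mul_nonneg_left ((norm_nonneg _).trans (hL.hess i W hW U hU hd))
    (Param.spec_pos (sub_ne_zero.2 hne))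

theorem norm_hess_le (hL : T.IsLipschitz ℓ ρ) {i : ι} (hr : T.Regular i) {W : Param m n}
    (hW : W ∈ T.stab) : ‖T.hess i W‖ ≤ ℓ i W := by
  refine (hasFDerivAt_grad i hW).le_of_lip' (hL.ell_nonneg hr hW) ?_
  have h1 : ∀ᶠ U in 𝓝 W, (U - W).spec < T.delta i W := by
    have hc : Continuous fun U : Param m n => (U - W).spec :=
      Param.continuous_spec.comp (continuous_id.sub continuous_const)
    refine (hc.tendsto W).eventually (gt_mem_nhds ?_)
    rw [sub_self, Param.spec_zero]
    exact hr.delta_pos hW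
  filter_upwards [h1] with U hU using
    hL.grad_frob i W hW U (hr.mem_stab_of_spec_le_delta hW hU.le) hU.le

theorem norm_hess_le_of_spec_le (hL : T.IsLipschitz ℓ ρ) {i : ι} (hr : T.Regular i)
    {W U : Param m n} (hW : W ∈ T.stab) {r : ℝ} (hrd : r ≤ T.delta i W) (hU : (U - W).spec ≤ r) :
    ‖T.hess i U‖ ≤ ‖T.hess i W‖ + ρ i W * r := by
  have h1 := hL.hess i W hW U (hr.mem_stab_of_spec_le_delta hW (hU.trans hrd)) (hU.trans hrd)
  have h2 := mul_le_mul_of_nonneg_left hU (hL.rho_nonneg hr hW)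
  have h3 := norm_le_norm_add_norm_sub' (T.hess i U) (T.hess i W)
  linarith

end IsLipschitz

theorem adapt_sub (η : ℝ) (i : ι) (W : Param m n) : T.adapt η i W - W = -(η • T.grad i W) := by
  simp [adapt]

theorem spec_adapt_sub {η : ℝ} (hη : 0 ≤ η) (i : ι) (W : Param m n) :
    (T.adapt η i W - W).spec = η * (T.grad i W).spec := by
  rw [adapt_sub, Param.spec_neg, Param.spec_smul, abs_of_nonneg hη]

namespace StepCondition

variable {ℓ ρ : ι → Param m n → ℝ} {α a b η β : ℝ} {W : Param m n}

/-- For δ(W) = 0 the second bound on η would read η‖∇C_i(W)‖ < 0. The step condition thus excludes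
degenerate data. -/
theorem deltaMin_pos (hs : T.StepCondition ℓ ρ α a b η β W) : 0 < T.deltaMin W := by
  refine (deltaMin_nonneg W).lt_of_ne' fun h0 => ?_
  obtain ⟨i⟩ := T.nonempty_index
  have h1 := hs.eta_stab i
  simp only [h0, mul_zero, zero_mul, zero_add] at h1
  exact absurd h1 (not_lt.2 (mul_nonneg hs.eta_pos.le (T.grad i W).spec_nonneg))

theorem regular (hs : T.StepCondition ℓ ρ α a b η β W) (i : ι) : T.Regular i :=
  regular_of_delta_pos (hs.deltaMin_pos.trans_le (deltaMin_le i W))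

/-- The inner step stays well inside the ball of radius `δ(W)`. -/
theorem eta_grad_lt (hL : T.IsLipschitz ℓ ρ) (hs : T.StepCondition ℓ ρ α a b η β W)
    (hW : W ∈ T.stab) (i : ι) : η * (T.grad i W).spec < T.deltaMin W := by
  have h1 := hs.eta_stab i
  have h2 := mul_nonneg hs.eta_pos.le (mul_nonneg (mul_nonneg hs.alpha_pos.le hs.deltaMin_pos.le)
    (hL.ell_nonneg (hs.regular i) hW))
  have h3 := mul_pos hs.alpha_pos hs.deltaMin_pos
  nlinarith

theorem spec_adapt_le (hL : T.IsLipschitz ℓ ρ) (hs : T.StepCondition ℓ ρ α a b η β W)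
    (hW : W ∈ T.stab) (i : ι) {t : ℝ} (ht : t ∈ Set.Icc (0 : ℝ) 1) :
    (T.adapt (t * η) i W - W).spec ≤ T.delta i W := by
  rw [spec_adapt_sub (mul_nonneg ht.1 hs.eta_pos.le), mul_assoc]
  have h1 := hs.eta_grad_lt hL hW i
  have h2 := mul_nonneg hs.eta_pos.le (T.grad i W).spec_nonneg
  exact (mul_le_of_le_one_left h2 ht.2).trans (h1.le.trans (deltaMin_le i W))

theorem adapt_mem_stab (hL : T.IsLipschitz ℓ ρ) (hs : T.StepCondition ℓ ρ α a b η β W)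
    (hW : W ∈ T.stab) (i : ι) {t : ℝ} (ht : t ∈ Set.Icc (0 : ℝ) 1) :
    T.adapt (t * η) i W ∈ T.stab :=
  mem_stab_of_spec_le_delta hW (hs.spec_adapt_le hL hW i ht)

theorem mem_mamlStab (hL : T.IsLipschitz ℓ ρ) (hs : T.StepCondition ℓ ρ α a b η β W)
    (hW : W ∈ T.stab) : W ∈ T.mamlStab η :=
  ⟨hW, fun i => by simpa using hs.adapt_mem_stab hL hW i (Set.right_mem_Icc.2 zero_le_one)⟩

/-- The bracket bounds the Hessian on the whole ball of radius δ_i(W), so η is an admissible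
gradient descent step for C_i. -/
theorem eta_hess_le (hL : T.IsLipschitz ℓ ρ) (hs : T.StepCondition ℓ ρ α a b η β W)
    (hW : W ∈ T.stab) (i : ι) : η * (‖T.hess i W‖ + ρ i W * T.delta i W) ≤ 1 := by
  have h1 := hs.eta_hess i
  have h2 := mul_nonneg hs.eta_pos.le (norm_nonneg (T.hess i W))
  have h3 := mul_nonneg hs.eta_pos.le
    (mul_nonneg (hL.rho_nonneg (hs.regular i) hW) (delta_nonneg (T := T) i W))
  nlinarith

/-- The inner gradient step does not increase the cost. -/
theorem cost_adapt_le (hL : T.IsLipschitz ℓ ρ) (hs : T.StepCondition ℓ ρ α a b η β W)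
    (hW : W ∈ T.stab) (i : ι) : T.cost i (T.adapt η i W) ≤ T.cost i W := by
  have hr := hs.regular i
  set K := ‖T.hess i W‖ + ρ i W * T.delta i W with hK
  have hK0 : 0 ≤ K := add_nonneg (norm_nonneg _)
    (mul_nonneg (hL.rho_nonneg hr hW) (delta_nonneg i W))
  have hseg : ∀ t : ℝ, W + t • (-(η • T.grad i W)) = T.adapt (t * η) i W := fun t => by
    rw [adapt, smul_neg, smul_smul, sub_eq_add_neg]
  have h := descent_along_segment (f := T.cost i) (x := W) (d := -(η • T.grad i W)) (K := K)
    (fun t ht => by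
      rw [hseg]
      exact differentiableAt_cost i (hs.adapt_mem_stab hL hW i ht))
    (fun t ht => by
      have h0 : (W - W).spec ≤ T.delta i W := by
        rw [sub_self, Param.spec_zero]
        exact delta_nonneg i W
      have h1 := (convex_spec_ball W (T.delta i W)).norm_image_sub_le_of_norm_hasFDerivWithin_le
        (f := T.grad i) (C := K)
        (fun V hV => (hasFDerivAt_grad i (mem_stab_of_spec_le_delta hW hV)).hasFDerivWithinAt)
        (fun V hV => hL.norm_hess_le_of_spec_le hr hW le_rfl hV) h0 (hs.spec_adapt_le hL hW i ht)
      rw [hseg]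
      refine h1.trans_eq ?_
      rw [← hseg, add_sub_cancel_left])
  have h1 : W + -(η • T.grad i W) = T.adapt η i W := by rw [adapt, sub_eq_add_neg]
  rw [h1] at h
  refine h.trans ?_
  change T.cost i W + ⟪T.grad i W, -(η • T.grad i W)⟫ + _ ≤ _
  rw [inner_neg_right, real_inner_smul_right, real_inner_self_eq_norm_sq, norm_neg, norm_smul,
    Real.norm_of_nonneg hs.eta_pos.le]
  have h2 := hs.eta_hess_le hL hW i
  have h3 : 0 ≤ η * ‖T.grad i W‖ ^ 2 := mul_nonneg hs.eta_pos.le (by positivity)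
  nlinarith

/-- The segment of the inner step stays in the ball where the Hessian has norm at most η⁻¹.
Consequently the factor 1 + η‖H‖ in L never exceeds 2. -/
theorem norm_meanHess_le (hL : T.IsLipschitz ℓ ρ) (hs : T.StepCondition ℓ ρ α a b η β W)
    (hW : W ∈ T.stab) (i : ι) : ‖T.meanHess η i W‖ ≤ η⁻¹ := by
  have h1 : ‖T.hess i W‖ + ρ i W * T.delta i W ≤ η⁻¹ := by
    rw [inv_eq_one_div, le_div_iff₀' hs.eta_pos]
    exact hs.eta_hess_le hL hW i
  have h := intervalIntegral.norm_integral_le_of_norm_le_const (a := (0 : ℝ)) (b := 1)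
    (f := fun t => T.hess i (T.adapt (t * η) i W)) (C := η⁻¹) fun t ht => by
      rw [Set.uIoc_of_le zero_le_one] at ht
      exact (hL.norm_hess_le_of_spec_le (hs.regular i) hW le_rfl
        (hs.spec_adapt_le hL hW i ⟨ht.1.le, ht.2⟩)).trans h1
  rw [sub_zero, abs_one, mul_one] at h
  exact h

/-- The mean value identity for the gradient along the inner step. -/
theorem grad_adapt (hL : T.IsLipschitz ℓ ρ) (hs : T.StepCondition ℓ ρ α a b η β W)
    (hW : W ∈ T.stab) (i : ι) :
    T.grad i (T.adapt η i W) = T.grad i W - η • T.meanHess η i W (T.grad i W) := by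
  have hder : ∀ t : ℝ, HasDerivAt (fun t : ℝ => T.adapt (t * η) i W) (-(η • T.grad i W)) t :=
    fun t => by
      have h1 := (((hasDerivAt_id t).mul_const η).smul_const (T.grad i W)).const_sub W
      simpa [adapt] using h1
  have hcont : ContinuousOn (fun t : ℝ => T.hess i (T.adapt (t * η) i W)) (Set.Icc 0 1) :=
    (continuousOn_hess i).comp (fun t _ => (hder t).continuousAt.continuousWithinAt)
      fun t ht => hs.adapt_mem_stab hL hW i ht
  have hess_int : IntervalIntegrable (fun t : ℝ => T.hess i (T.adapt (t * η) i W)) volume 0 1 :=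
    ContinuousOn.intervalIntegrable (by rwa [Set.uIcc_of_le zero_le_one])
  have hftc := intervalIntegral.integral_eq_sub_of_hasDerivAt (a := (0 : ℝ)) (b := 1)
    (f := fun t => T.grad i (T.adapt (t * η) i W))
    (f' := fun t => T.hess i (T.adapt (t * η) i W) (-(η • T.grad i W)))
    (fun t ht => by
      rw [Set.uIcc_of_le zero_le_one] at ht
      exact (hasFDerivAt_grad i (hs.adapt_mem_stab hL hW i ht)).comp_hasDerivAt t (hder t))
    (ContinuousOn.intervalIntegrable (by
      rw [Set.uIcc_of_le zero_le_one]
      exact hcont.clm_apply continuousOn_const))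
  rw [← ContinuousLinearMap.intervalIntegral_apply hess_int] at hftc
  simp only [one_mul, zero_mul] at hftc
  have h0 : T.adapt 0 i W = W := by simp [adapt]
  rw [h0] at hftc
  have h1 : T.meanHess η i W (-(η • T.grad i W)) = T.grad i (T.adapt η i W) - T.grad i W := hftc
  rw [map_neg, map_smul] at h1
  rw [sub_eq_add_neg, h1, add_sub_cancel]

theorem norm_grad_adapt_le (hL : T.IsLipschitz ℓ ρ) (hs : T.StepCondition ℓ ρ α a b η β W)
    (hW : W ∈ T.stab) (i : ι) :
    ‖T.grad i (T.adapt η i W)‖ ≤ (1 + η * ‖T.meanHess η i W‖) * ‖T.grad i W‖ := by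
  rw [hs.grad_adapt hL hW i]
  have h1 := norm_sub_le (T.grad i W) (η • T.meanHess η i W (T.grad i W))
  have h2 := (T.meanHess η i W).le_opNorm (T.grad i W)
  rw [norm_smul, Real.norm_of_nonneg hs.eta_pos.le] at h1
  have h3 := mul_le_mul_of_nonneg_left h2 hs.eta_pos.le
  linarith

end StepCondition

end Tasks

/-! ### The outer step: stability, smoothness of the objective, decrease -/

namespace Tasks

variable {n m : ℕ} {ι : Type} [Fintype ι] {T : Tasks n m ι}

namespace StepCondition

variable {ℓ ρ : ι → Param m n → ℝ} {α a b η β : ℝ} {W : Param m n}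

theorem iSup_ell_nonneg (hL : T.IsLipschitz ℓ ρ) (hs : T.StepCondition ℓ ρ α a b η β W)
    (hW : W ∈ T.stab) : 0 ≤ ⨆ i, ℓ i W :=
  Real.iSup_nonneg fun i => hL.ell_nonneg (hs.regular i) hW

theorem iSup_rho_nonneg (hL : T.IsLipschitz ℓ ρ) (hs : T.StepCondition ℓ ρ α a b η β W)
    (hW : W ∈ T.stab) : 0 ≤ ⨆ i, ρ i W :=
  Real.iSup_nonneg fun i => hL.rho_nonneg (hs.regular i) hW

theorem iSup_ell_adapt_nonneg (hL : T.IsLipschitz ℓ ρ) (hs : T.StepCondition ℓ ρ α a b η β W)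
    (hW : W ∈ T.stab) : 0 ≤ ⨆ i, ℓ i (T.adapt η i W) :=
  Real.iSup_nonneg fun i => hL.ell_nonneg (hs.regular i) ((hs.mem_mamlStab hL hW).2 i)

theorem L_nonneg (hL : T.IsLipschitz ℓ ρ) (hs : T.StepCondition ℓ ρ α a b η β W)
    (hW : W ∈ T.stab) : 0 ≤ T.L ℓ ρ η W := by
  have h1 := hs.iSup_ell_nonneg hL hW
  have h2 := hs.iSup_rho_nonneg hL hW
  have h3 := hs.iSup_ell_adapt_nonneg hL hW
  have h4 := hs.eta_pos
  have h5 := hs.deltaMin_pos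
  have h6 : 0 ≤ ⨆ i, ‖T.meanHess η i W‖ := Real.iSup_nonneg fun i => norm_nonneg _
  have h7 : 0 ≤ ∑ i, T.p i * ‖T.grad i W‖ :=
    Finset.sum_nonneg fun i _ => mul_nonneg (T.p_nonneg i) (norm_nonneg _)
  unfold L
  positivity

/-- If L were 0, both quotients a/L and b/L would be 0 by convention, and the bounds on β would read
0 < β < 0. -/
theorem L_pos (hL : T.IsLipschitz ℓ ρ) (hs : T.StepCondition ℓ ρ α a b η β W)
    (hW : W ∈ T.stab) : 0 < T.L ℓ ρ η W := by
  refine (hs.L_nonneg hL hW).lt_of_ne' fun h0 => ?_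
  have h1 := hs.beta_gt
  have h2 := hs.beta_lt
  rw [h0, div_zero] at h1 h2
  exact lt_asymm h1 h2

theorem beta_pos (hL : T.IsLipschitz ℓ ρ) (hs : T.StepCondition ℓ ρ α a b η β W)
    (hW : W ∈ T.stab) (hab : b ^ 2 < 2 * a) : 0 < β := by
  have ha : 0 < a := by nlinarith [sq_nonneg b]
  exact (div_pos ha (hs.L_pos hL hW)).trans hs.beta_gt

/-- The outer step preserves stability. -/
theorem step_mem_stab (hL : T.IsLipschitz ℓ ρ) (hs : T.StepCondition ℓ ρ α a b η β W)
    (hW : W ∈ T.stab) (hab : b ^ 2 < 2 * a) : W - β • T.gradF η W ∈ T.stab := by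
  obtain ⟨i⟩ := T.nonempty_index
  refine (hs.regular i).mem_stab_of_spec_lt_deltaBar hW ?_
  rw [sub_sub_cancel_left, Param.spec_neg, Param.spec_smul, abs_of_pos (hs.beta_pos hL hW hab)]
  have h0 := (T.gradF η W).spec_nonneg
  have h1 : β * (T.gradF η W).spec < α * T.deltaBar i W :=
    (mul_le_mul_of_nonneg_right hs.beta_lt.le h0).trans_lt (hs.beta_stab i)
  have h2 := mul_nonneg (hs.beta_pos hL hW hab).le h0
  have h3 : 0 < T.deltaBar i W := pos_of_mul_pos_right (h2.trans_lt h1) hs.alpha_pos.le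
  exact h1.trans (mul_lt_of_lt_one_left h3 hs.alpha_lt)

section Nearby

variable {U : Param m n}

theorem nearby_mem_stab (hs : T.StepCondition ℓ ρ α a b η β W)
    (hW : W ∈ T.stab) (hU : (U - W).spec ≤ α * T.deltaMin W) (i : ι) :
    (U - W).spec ≤ T.delta i W ∧ U ∈ T.stab := by
  have h1 : (U - W).spec ≤ T.delta i W :=
    hU.trans ((mul_le_of_le_one_left hs.deltaMin_pos.le hs.alpha_lt.le).trans (deltaMin_le i W))
  exact ⟨h1, mem_stab_of_spec_le_delta hW h1⟩

theorem adapt_sub_adapt (U W : Param m n) (i : ι) :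
    T.adapt η i U - T.adapt η i W = (U - W) - η • (T.grad i U - T.grad i W) := by
  simp only [adapt, smul_sub]
  abel

/-- The left side is at most (1 + ηℓ_i)αδ, and the second bound on η is a rearrangement of (1 +
ηℓ_i)αδ < δ - η‖∇C_i‖. The slack η‖∇C_i‖ is spent on the distance from W to its adapted parameter.
-/
theorem spec_adapt_sub_adapt_lt (hL : T.IsLipschitz ℓ ρ) (hs : T.StepCondition ℓ ρ α a b η β W)
    (hW : W ∈ T.stab) (hU : (U - W).spec ≤ α * T.deltaMin W) (i : ι) :
    (T.adapt η i U - T.adapt η i W).spec < T.deltaMin W - η * (T.grad i W).spec := by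
  obtain ⟨hd, hUs⟩ := hs.nearby_mem_stab hW hU i
  have h1 := hL.grad_spec i W hW U hUs hd
  have hℓ := hL.ell_nonneg (hs.regular i) hW
  have hη := hs.eta_pos
  have h2 : (T.adapt η i U - T.adapt η i W).spec ≤
      (U - W).spec + η * (T.grad i U - T.grad i W).spec := by
    rw [adapt_sub_adapt, sub_eq_add_neg (U - W)]
    refine (Param.spec_add_le _ _).trans_eq ?_
    rw [Param.spec_neg, Param.spec_smul, abs_of_pos hη]
  have h3 : η * (T.grad i U - T.grad i W).spec ≤ η * (ℓ i W * (α * T.deltaMin W)) := by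
    gcongr
    exact h1.trans (mul_le_mul_of_nonneg_left hU hℓ)
  have h4 := hs.eta_stab i
  nlinarith

theorem nearby_mem_mamlStab (hL : T.IsLipschitz ℓ ρ) (hs : T.StepCondition ℓ ρ α a b η β W)
    (hW : W ∈ T.stab) (hU : (U - W).spec ≤ α * T.deltaMin W) : U ∈ T.mamlStab η := by
  obtain ⟨i₀⟩ := T.nonempty_index
  refine ⟨(hs.nearby_mem_stab hW hU i₀).2, fun i => ?_⟩
  refine mem_stab_of_spec_le_delta (i := i) hW ?_
  have h1 := hs.spec_adapt_sub_adapt_lt hL hW hU i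
  have h2 := Param.spec_add_le (T.adapt η i U - T.adapt η i W) (T.adapt η i W - W)
  rw [sub_add_sub_cancel, spec_adapt_sub hs.eta_pos.le] at h2
  linarith [deltaMin_le (T := T) i W]

/-- The inner step does not raise the cost, so δ_i at the adapted parameter is still at least δ_i(W)
- η‖∇C_i(W)‖. This licenses the constant ℓ_i there. -/
theorem spec_adapt_sub_adapt_le_delta (hL : T.IsLipschitz ℓ ρ)
    (hs : T.StepCondition ℓ ρ α a b η β W)
    (hW : W ∈ T.stab) (hU : (U - W).spec ≤ α * T.deltaMin W) (i : ι) :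
    (T.adapt η i U - T.adapt η i W).spec ≤ T.delta i (T.adapt η i W) := by
  have h1 := hs.spec_adapt_sub_adapt_lt hL hW hU i
  have h2 := (hs.regular i).delta_sub_le hW ((hs.mem_mamlStab hL hW).2 i)
    (hs.cost_adapt_le hL hW i)
  rw [spec_adapt_sub hs.eta_pos.le] at h2
  linarith [deltaMin_le (T := T) i W]

/-- The gradient of one summand of the objective varies at most linearly near `W`. -/
theorem norm_term_sub_le (hL : T.IsLipschitz ℓ ρ) (hs : T.StepCondition ℓ ρ α a b η β W)
    (hW : W ∈ T.stab) (hU : (U - W).spec ≤ α * T.deltaMin W) (i : ι) :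
    ‖T.G η i U (T.grad i (T.adapt η i U)) - T.G η i W (T.grad i (T.adapt η i W))‖ ≤
      ((⨆ i, ℓ i (T.adapt η i W)) * (1 + η * ((⨆ i, ℓ i W) + T.deltaMin W * ⨆ i, ρ i W))
        * (1 + η * ⨆ i, ℓ i W)
        + η * (⨆ i, ρ i W) * (1 + η * ⨆ i, ‖T.meanHess η i W‖) * ‖T.grad i W‖) * ‖U - W‖ := by
  obtain ⟨hd, hUs⟩ := hs.nearby_mem_stab hW hU i
  have hr := hs.regular i
  have hη := hs.eta_pos
  have hδ := hs.deltaMin_pos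
  have hWm := hs.mem_mamlStab hL hW
  have hUm := hs.nearby_mem_mamlStab hL hW hU
  have hU' : (U - W).spec ≤ T.deltaMin W :=
    hU.trans (mul_le_of_le_one_left hδ.le hs.alpha_lt.le)
  have hℓi : ℓ i W ≤ ⨆ i, ℓ i W := le_iSup_index (fun i => ℓ i W) i
  have hρi : ρ i W ≤ ⨆ i, ρ i W := le_iSup_index (fun i => ρ i W) i
  have hℓ'i : ℓ i (T.adapt η i W) ≤ ⨆ i, ℓ i (T.adapt η i W) :=
    le_iSup_index (fun i => ℓ i (T.adapt η i W)) i
  have hHi : ‖T.meanHess η i W‖ ≤ ⨆ i, ‖T.meanHess η i W‖ :=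
    le_iSup_index (fun i => ‖T.meanHess η i W‖) i
  have hℓ0 := hL.ell_nonneg hr hW
  have hρ0 := hL.rho_nonneg hr hW
  have hℓ'0 := hL.ell_nonneg hr (hWm.2 i)
  have hH0 := norm_nonneg (T.meanHess η i W)
  have hHS := hs.norm_grad_adapt_le hL hW i
  set S := ⨆ i, ℓ i W
  set P := ⨆ i, ρ i W
  set S' := ⨆ i, ℓ i (T.adapt η i W)
  set H := ⨆ i, ‖T.meanHess η i W‖
  have hS0 : 0 ≤ S := hℓ0.trans hℓi
  have hP0 : 0 ≤ P := hρ0.trans hρi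
  have hS'0 : 0 ≤ S' := hℓ'0.trans hℓ'i
  have hHn : 0 ≤ H := hH0.trans hHi
  have hG : ‖T.G η i U‖ ≤ 1 + η * (S + T.deltaMin W * P) := by
    have h1 := hL.norm_hess_le_of_spec_le hr hW (deltaMin_le i W) hU'
    have h2 := hL.norm_hess_le hr hW
    have h3 := norm_sub_le (ContinuousLinearMap.id ℝ (Param m n)) (η • T.hess i U)
    rw [norm_smul, Real.norm_of_nonneg hη.le] at h3
    have h4 := ContinuousLinearMap.norm_id_le (𝕜 := ℝ) (E := Param m n)
    have h5 : η * ‖T.hess i U‖ ≤ η * (S + T.deltaMin W * P) := by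
      gcongr
      nlinarith [mul_le_mul_of_nonneg_right hρi hδ.le]
    exact h3.trans (add_le_add h4 h5)
  have hgr : ‖T.grad i (T.adapt η i U) - T.grad i (T.adapt η i W)‖ ≤
      S' * ((1 + η * S) * ‖U - W‖) := by
    have h1 := hL.grad_frob i (T.adapt η i W) (hWm.2 i) (T.adapt η i U) (hUm.2 i)
      (hs.spec_adapt_sub_adapt_le_delta hL hW hU i)
    have h2 := hL.grad_frob i W hW U hUs hd
    have h3 : ‖T.adapt η i U - T.adapt η i W‖ ≤ ‖U - W‖ + η * ‖T.grad i U - T.grad i W‖ := by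
      rw [adapt_sub_adapt]
      refine (norm_sub_le _ _).trans_eq ?_
      rw [norm_smul, Real.norm_of_nonneg hη.le]
    have h4 : ‖T.grad i U - T.grad i W‖ ≤ S * ‖U - W‖ := h2.trans (by gcongr)
    have h5 : ‖T.adapt η i U - T.adapt η i W‖ ≤ (1 + η * S) * ‖U - W‖ := by
      have := mul_le_mul_of_nonneg_left h4 hη.le
      linarith
    exact h1.trans (mul_le_mul hℓ'i h5 (norm_nonneg _) hS'0)
  have hGd : ‖T.G η i U - T.G η i W‖ ≤ η * (P * ‖U - W‖) := by
    have h1 := hL.hess i W hW U hUs hd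
    have h2 : T.G η i U - T.G η i W = -(η • (T.hess i U - T.hess i W)) := by
      simp only [G, smul_sub]
      abel
    rw [h2, norm_neg, norm_smul, Real.norm_of_nonneg hη.le]
    gcongr
    exact h1.trans (mul_le_mul hρi (Param.spec_le_norm _) (Param.spec_nonneg _) hP0)
  have hgW : ‖T.grad i (T.adapt η i W)‖ ≤ (1 + η * H) * ‖T.grad i W‖ :=
    hHS.trans (by gcongr)
  -- Product rule: the variation of the adapted gradient gives the first term of L, that of G_i the
  -- second.
  have hsplit : T.G η i U (T.grad i (T.adapt η i U)) - T.G η i W (T.grad i (T.adapt η i W)) =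
      T.G η i U (T.grad i (T.adapt η i U) - T.grad i (T.adapt η i W)) +
        (T.G η i U - T.G η i W) (T.grad i (T.adapt η i W)) := by
    rw [map_sub, _root_.sub_apply]
    abel
  rw [hsplit]
  have e1 : ‖T.G η i U (T.grad i (T.adapt η i U) - T.grad i (T.adapt η i W))‖ ≤
      (1 + η * (S + T.deltaMin W * P)) * (S' * ((1 + η * S) * ‖U - W‖)) :=
    ((T.G η i U).le_opNorm _).trans (mul_le_mul hG hgr (norm_nonneg _) (by positivity))
  have e2 : ‖(T.G η i U - T.G η i W) (T.grad i (T.adapt η i W))‖ ≤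
      (η * (P * ‖U - W‖)) * ((1 + η * H) * ‖T.grad i W‖) :=
    ((T.G η i U - T.G η i W).le_opNorm _).trans
      (mul_le_mul hGd hgW (norm_nonneg _) (by positivity))
  refine (norm_add_le _ _).trans ((add_le_add e1 e2).trans_eq ?_)
  ring

theorem norm_gradF_sub_le (hL : T.IsLipschitz ℓ ρ) (hs : T.StepCondition ℓ ρ α a b η β W)
    (hW : W ∈ T.stab) (hU : (U - W).spec ≤ α * T.deltaMin W) :
    ‖T.gradF η U - T.gradF η W‖ ≤ T.L ℓ ρ η W * ‖U - W‖ := by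
  rw [gradF_eq (hs.nearby_mem_mamlStab hL hW hU), gradF_eq (hs.mem_mamlStab hL hW),
    ← Finset.sum_sub_distrib]
  refine (norm_sum_le _ _).trans ?_
  set c₁ := (⨆ i, ℓ i (T.adapt η i W)) *
    (1 + η * ((⨆ i, ℓ i W) + T.deltaMin W * ⨆ i, ρ i W)) * (1 + η * ⨆ i, ℓ i W) with hc₁
  set c₂ := η * (⨆ i, ρ i W) * (1 + η * ⨆ i, ‖T.meanHess η i W‖) with hc₂
  have h1 : ∀ i ∈ Finset.univ, ‖T.p i • T.G η i U (T.grad i (T.adapt η i U)) -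
      T.p i • T.G η i W (T.grad i (T.adapt η i W))‖ ≤
      T.p i * ((c₁ + c₂ * ‖T.grad i W‖) * ‖U - W‖) := fun i _ => by
    rw [← smul_sub, norm_smul, Real.norm_of_nonneg (T.p_nonneg i)]
    exact mul_le_mul_of_nonneg_left (hs.norm_term_sub_le hL hW hU i) (T.p_nonneg i)
  have h2 : T.L ℓ ρ η W = c₁ * ∑ i, T.p i + c₂ * ∑ i, T.p i * ‖T.grad i W‖ := by
    rw [T.p_sum, mul_one, L]
  refine (Finset.sum_le_sum h1).trans_eq ?_
  rw [h2, Finset.mul_sum, Finset.mul_sum, ← Finset.sum_add_distrib, Finset.sum_mul]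
  exact Finset.sum_congr rfl fun i _ => by ring

end Nearby

/-- The objective decreases by a definite amount in one outer step. -/
theorem objective_step_le (hL : T.IsLipschitz ℓ ρ) (hs : T.StepCondition ℓ ρ α a b η β W)
    (hW : W ∈ T.stab) (hab : b ^ 2 < 2 * a)
    (hβ : ∀ i, β * (T.gradF η W).spec < α * T.delta i W) :
    T.objective η (W - β • T.gradF η W) ≤
      T.objective η W - (2 * a - b ^ 2) / (2 * T.L ℓ ρ η W) * ‖T.gradF η W‖ ^ 2 := by
  have hβ0 := hs.beta_pos hL hW hab
  have hLp := hs.L_pos hL hW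
  have : Nonempty ι := T.nonempty_index
  have hmin : β * (T.gradF η W).spec ≤ α * T.deltaMin W := by
    obtain ⟨i, hi⟩ := exists_eq_ciInf_of_finite (f := fun i => T.delta i W)
    rw [deltaMin, ← hi]
    exact (hβ i).le
  have hnear : ∀ t ∈ Set.Icc (0 : ℝ) 1,
      (W + t • (-(β • T.gradF η W)) - W).spec ≤ α * T.deltaMin W := fun t ht => by
    rw [add_sub_cancel_left, Param.spec_smul, Param.spec_neg, Param.spec_smul, abs_of_pos hβ0,
      abs_of_nonneg ht.1]
    exact (mul_le_of_le_one_left (mul_nonneg hβ0.le (Param.spec_nonneg _)) ht.2).trans hmin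
  have h := descent_along_segment (f := T.objective η) (x := W) (d := -(β • T.gradF η W))
    (K := T.L ℓ ρ η W)
    (fun t ht => (hasGradientAt_objective
      (hs.nearby_mem_mamlStab hL hW (hnear t ht))).differentiableAt)
    (fun t ht => by
      have h1 := hs.norm_gradF_sub_le hL hW (hnear t ht)
      rwa [add_sub_cancel_left] at h1)
  rw [← sub_eq_add_neg] at h
  refine h.trans ?_
  change T.objective η W + ⟪T.gradF η W, -(β • T.gradF η W)⟫ + _ ≤ _
  rw [inner_neg_right, real_inner_smul_right, real_inner_self_eq_norm_sq, norm_neg, norm_smul,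
    Real.norm_of_nonneg hβ0.le]
  have h1 := hs.beta_gt
  have h2 := hs.beta_lt
  rw [div_lt_iff₀ hLp] at h1
  rw [lt_div_iff₀ hLp] at h2
  -- The right side is (2βL - (βL)²)/(2L), and a < βL < b.
  have h3 : (2 * a - b ^ 2) / (2 * T.L ℓ ρ η W) ≤ β - T.L ℓ ρ η W / 2 * β ^ 2 := by
    rw [div_le_iff₀ (by positivity)]
    have h4 : (β * T.L ℓ ρ η W) ^ 2 ≤ b ^ 2 := by
      have : 0 ≤ β * T.L ℓ ρ η W := by positivity
      gcongr
    nlinarith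
  have h5 := mul_le_mul_of_nonneg_right h3 (sq_nonneg ‖T.gradF η W‖)
  nlinarith

end StepCondition

end Tasks

/-! ### Runs of the algorithm: compactness and iteration count -/

namespace Tasks

variable {n m : ℕ} {ι : Type} [Fintype ι] {T : Tasks n m ι}

theorem IsRun.succ_eq {η β : ℕ → ℝ} {W : ℕ → Param m n} (hrun : T.IsRun η β W) {j : ℕ}
    (hj : W j ∈ T.mamlStab (η j)) : W (j + 1) = W j - β j • T.gradF (η j) (W j) := by
  rw [hrun j, gradF_eq hj]

theorem IsRun.mem_stab {ℓ ρ : ι → Param m n → ℝ} (hL : T.IsLipschitz ℓ ρ) {η β : ℕ → ℝ}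
    {W : ℕ → Param m n} (hrun : T.IsRun η β W) {α : ℕ → ℝ} {a b : ℝ} (hab : b ^ 2 < 2 * a)
    (hs : ∀ j, T.StepCondition ℓ ρ (α j) a b (η j) (β j) (W j)) (h0 : W 0 ∈ T.stab) (j : ℕ) :
    W j ∈ T.stab := by
  induction j with
  | zero => exact h0
  | succ j ih =>
    rw [hrun.succ_eq ((hs j).mem_mamlStab hL ih)]
    exact (hs j).step_mem_stab hL ih hab

theorem objective_nonneg (η : ℝ) (W : Param m n) : 0 ≤ T.objective η W :=
  Finset.sum_nonneg fun i _ => mul_nonneg (T.p_nonneg i) (cost_nonneg i _)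

theorem optValue_le {η : ℝ} {W : Param m n} (hW : W ∈ T.mamlStab η) :
    T.optValue η ≤ T.objective η W :=
  csInf_le ⟨0, by rintro _ ⟨U, -, rfl⟩; exact objective_nonneg η U⟩ ⟨W, hW, rfl⟩

theorem exists_p_pos (T : Tasks n m ι) : ∃ i, 0 < T.p i := by
  by_contra! h
  have := Finset.sum_nonpos fun i (_ : i ∈ Finset.univ) => h i
  rw [T.p_sum] at this
  exact absurd this (by norm_num)

/-- Bounds the initial objective by the costs on 𝒲 alone, since inner steps do not raise them. -/
theorem StepCondition.objective_le {ℓ ρ : ι → Param m n → ℝ} {α a b η β : ℝ} {W : Param m n}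
    (hL : T.IsLipschitz ℓ ρ) (hs : T.StepCondition ℓ ρ α a b η β W) (hW : W ∈ T.stab) {c : ℝ}
    (hc : ∀ i, T.cost i W ≤ c) : T.objective η W ≤ c := by
  calc T.objective η W ≤ ∑ i, T.p i * c := Finset.sum_le_sum fun i _ =>
        mul_le_mul_of_nonneg_left ((hs.cost_adapt_le hL hW i).trans (hc i)) (T.p_nonneg i)
    _ = c := by rw [← Finset.sum_mul, T.p_sum, one_mul]

/-- Parameters that satisfy the step condition and have bounded objective lie in a compact set of
stabilizing parameters. -/
theorem exists_compact_of_objective_le (T : Tasks n m ι) (hreg : ∀ i, T.Regular i)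
    {ℓ ρ : ι → Param m n → ℝ}
    (hL : T.IsLipschitz ℓ ρ) (η c : ℝ) :
    ∃ K : Set (Param m n), IsCompact K ∧ K ⊆ T.stab ∧ ∀ (α a b β : ℝ) (W : Param m n),
      W ∈ T.stab → T.StepCondition ℓ ρ α a b η β W → T.objective η W ≤ c → W ∈ K := by
  obtain ⟨i, hi⟩ := T.exists_p_pos
  have hr := hreg i
  obtain ⟨κ, hκ, hspec⟩ := Param.exists_norm_le_spec m n
  have hκ0 : 0 < κ := by linarith
  set K₁ := {V | V ∈ T.stab ∧ T.cost i V ≤ c / T.p i}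
  have hK₁ : IsCompact K₁ := hr.isCompact_sublevel _
  obtain ⟨r, hr0, hrs⟩ := hK₁.exists_cthickening_subset_open T.isOpen_stab fun V hV => hV.1
  -- The threshold r/κ for δ_i(W) separates two cases. Below it, the inner step has Frobenius length
  -- at most r, so W lies in the thickening of K₁. Above it, the formula for δ_i with ‖A - BW‖ + 1 ≥
  -- 1 gives C_i(W) ≤ c'.
  set c' := sigmaMin (T.Q i) * T.mu / (4 * specNorm T.B * (r / κ)) with hc'
  refine ⟨Metric.cthickening r K₁ ∪ {V | V ∈ T.stab ∧ T.cost i V ≤ c'},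
    hK₁.cthickening.union (hr.isCompact_sublevel _),
    Set.union_subset hrs fun V hV => hV.1, fun α a b β W hW hs hobj => ?_⟩
  have hV : T.adapt η i W ∈ K₁ := by
    refine ⟨(hs.mem_mamlStab hL hW).2 i, ?_⟩
    rw [le_div_iff₀' hi]
    refine le_trans ?_ hobj
    exact Finset.single_le_sum (f := fun i => T.p i * T.cost i (T.adapt η i W))
      (fun k _ => mul_nonneg (T.p_nonneg k) (cost_nonneg k _)) (Finset.mem_univ i)
  rcases le_total (T.delta i W) (r / κ) with hle | hle
  · left
    refine Metric.mem_cthickening_of_dist_le W (T.adapt η i W) r K₁ hV ?_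
    rw [dist_comm, dist_eq_norm]
    refine (hspec _).trans ?_
    rw [spec_adapt_sub hs.eta_pos.le]
    have h1 := (hs.eta_grad_lt hL hW i).le.trans ((deltaMin_le i W).trans hle)
    rwa [le_div_iff₀' hκ0] at h1
  · right
    refine ⟨hW, ?_⟩
    have hC := hr.cost_pos hW
    have hB := hr.B_pos
    have hx : 0 ≤ specNorm (T.closedLoop W) := norm_nonneg _
    have hrk : 0 < r / κ := div_pos hr0 hκ0
    rw [hc', le_div_iff₀ (by positivity)]
    rw [delta, le_div_iff₀ (by positivity)] at hle
    refine le_trans ?_ hle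
    have : 0 ≤ r / κ * (4 * T.cost i W * specNorm T.B) * specNorm (T.closedLoop W) := by positivity
    nlinarith

/-- The smoothness constant `L` is bounded along parameters of bounded objective. -/
theorem exists_L_le (T : Tasks n m ι) (hreg : ∀ i, T.Regular i) {ℓ ρ : ι → Param m n → ℝ}
    (hL : T.IsLipschitz ℓ ρ) {η : ℝ} (hη : 0 < η) (c : ℝ) :
    ∃ M : ℝ, ∀ (α a b β : ℝ) (W : Param m n), W ∈ T.stab → T.StepCondition ℓ ρ α a b η β W →
      T.objective η W ≤ c → T.L ℓ ρ η W ≤ M := by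
  have : Nonempty ι := T.nonempty_index
  obtain ⟨K, hK, hKs, hmem⟩ := T.exists_compact_of_objective_le hreg hL η c
  have hcont : ∀ i, ∃ M, ∀ W ∈ K, T.cost i W ≤ M ∧ ‖T.grad i W‖ ≤ M ∧ T.delta i W ≤ M := fun i => by
    obtain ⟨M₁, h₁⟩ := (hK.image_of_continuousOn (f := T.cost i)
      fun W hW => (continuousAt_cost i (hKs hW)).continuousWithinAt).bddAbove
    obtain ⟨M₂, h₂⟩ := (hK.image_of_continuousOn ((continuousOn_grad i).mono hKs).norm).bddAbove
    obtain ⟨M₃, h₃⟩ := (hK.image_of_continuousOn ((continuousOn_delta i).mono hKs)).bddAbove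
    exact ⟨max M₁ (max M₂ M₃), fun W hW => ⟨(h₁ ⟨W, hW, rfl⟩).trans (le_max_left _ _),
      (h₂ ⟨W, hW, rfl⟩).trans ((le_max_left _ _).trans (le_max_right _ _)),
      (h₃ ⟨W, hW, rfl⟩).trans ((le_max_right _ _).trans (le_max_right _ _))⟩⟩
  choose M₁ hM₁ using hcont
  choose M₂ hM₂ using fun i => hL.bdd i K hKs hK
  -- Adapted parameters may leave K, but their cost does not increase, so they stay in a compact
  -- sublevel set.
  choose M₃ hM₃ using fun i => hL.bdd i {V | V ∈ T.stab ∧ T.cost i V ≤ M₁ i} (fun V hV => hV.1)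
    ((hreg i).isCompact_sublevel _)
  set g := ⨆ i, M₁ i
  set p := ⨆ i, M₂ i
  set q := ⨆ i, M₃ i
  refine ⟨q * (1 + η * (p + g * p)) * (1 + η * p) + η * p * (1 + η * η⁻¹) * g,
    fun α a b β W hW hs hobj => ?_⟩
  have hWK := hmem α a b β W hW hs hobj
  have hℓ0 := hs.iSup_ell_nonneg hL hW
  have hρ0 := hs.iSup_rho_nonneg hL hW
  have hℓ'0 := hs.iSup_ell_adapt_nonneg hL hW
  have hδ0 := hs.deltaMin_pos
  have hH0 : 0 ≤ ⨆ i, ‖T.meanHess η i W‖ := Real.iSup_nonneg fun i => norm_nonneg _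
  have hE0 : 0 ≤ ∑ i, T.p i * ‖T.grad i W‖ :=
    Finset.sum_nonneg fun i _ => mul_nonneg (T.p_nonneg i) (norm_nonneg _)
  have hℓ : ⨆ i, ℓ i W ≤ p := ciSup_le fun i => ((hM₂ i W hWK).1).trans (le_iSup_index M₂ i)
  have hρ : ⨆ i, ρ i W ≤ p := ciSup_le fun i => ((hM₂ i W hWK).2).trans (le_iSup_index M₂ i)
  have hℓ' : ⨆ i, ℓ i (T.adapt η i W) ≤ q := ciSup_le fun i =>
    ((hM₃ i _ ⟨(hs.mem_mamlStab hL hW).2 i,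
      (hs.cost_adapt_le hL hW i).trans (hM₁ i W hWK).1⟩).1).trans (le_iSup_index M₃ i)
  have hH : ⨆ i, ‖T.meanHess η i W‖ ≤ η⁻¹ := ciSup_le fun i => hs.norm_meanHess_le hL hW i
  have hδ : T.deltaMin W ≤ g := by
    obtain ⟨i⟩ := T.nonempty_index
    exact (deltaMin_le i W).trans ((hM₁ i W hWK).2.2.trans (le_iSup_index M₁ i))
  have hE : ∑ i, T.p i * ‖T.grad i W‖ ≤ g := by
    calc ∑ i, T.p i * ‖T.grad i W‖ ≤ ∑ i, T.p i * g := Finset.sum_le_sum fun i _ =>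
          mul_le_mul_of_nonneg_left ((hM₁ i W hWK).2.1.trans (le_iSup_index M₁ i)) (T.p_nonneg i)
      _ = g := by rw [← Finset.sum_mul, T.p_sum, one_mul]
  have hp0 := hℓ0.trans hℓ
  have hq0 := hℓ'0.trans hℓ'
  have hg0 := hE0.trans hE
  unfold L
  gcongr

/-- The complexity bound for a run whose smoothness constants are bounded by `M`. -/
theorem exists_iteration {ℓ ρ : ι → Param m n → ℝ} (hL : T.IsLipschitz ℓ ρ) {η : ℝ} {c M : ℝ}
    (hM : ∀ (α a b β : ℝ) (W : Param m n), W ∈ T.stab → T.StepCondition ℓ ρ α a b η β W →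
      T.objective η W ≤ c → T.L ℓ ρ η W ≤ M)
    {W : ℕ → Param m n} {α β : ℕ → ℝ} {a b : ℝ} (h0 : W 0 ∈ T.stab)
    (hc : T.objective η (W 0) ≤ c) (hab : b ^ 2 < 2 * a)
    (hrun : T.IsRun (fun _ => η) β W)
    (hs : ∀ j, T.StepCondition ℓ ρ (α j) a b η (β j) (W j))
    (hβ : ∀ j i, β j * (T.gradF η (W j)).spec < α j * T.delta i (W j)) {ε : ℝ} (hε : 0 < ε) :
    ∃ N : ℕ, (N : ℝ) ≤ (T.objective η (W 0) - T.optValue η) * (2 * M) /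
      ((2 * a - b ^ 2) * ε ^ 2) ∧ ‖T.gradF η (W N)‖ ≤ ε := by
  have hab' : 0 < 2 * a - b ^ 2 := by linarith
  have hW : ∀ j, W j ∈ T.stab := hrun.mem_stab hL hab hs h0
  have hstep : ∀ j, T.objective η (W (j + 1)) ≤ T.objective η (W j) -
      (2 * a - b ^ 2) / (2 * T.L ℓ ρ η (W j)) * ‖T.gradF η (W j)‖ ^ 2 := fun j => by
    rw [hrun.succ_eq ((hs j).mem_mamlStab hL (hW j))]
    exact (hs j).objective_step_le hL (hW j) hab (hβ j)
  -- The bound M on L is available only while F ≤ c. The decrease in `hstep` uses the actual L at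
  -- W_j, so there is no circularity.
  have hmono : ∀ j, T.objective η (W j) ≤ c := fun j => by
    induction j with
    | zero => exact hc
    | succ j ih =>
      refine (hstep j).trans ((sub_le_self _ ?_).trans ih)
      have := (hs j).L_pos hL (hW j)
      positivity
  have hLM : ∀ j, T.L ℓ ρ η (W j) ≤ M := fun j => hM _ _ _ _ _ (hW j) (hs j) (hmono j)
  have hMpos : 0 < M := ((hs 0).L_pos hL (hW 0)).trans_le (hLM 0)
  set s := (2 * a - b ^ 2) / (2 * M) * ε ^ 2 with hsdef
  have hs0 : 0 < s := by positivity
  have hdec : ∀ N : ℕ, (∀ j < N, ε < ‖T.gradF η (W j)‖) →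
      N * s ≤ T.objective η (W 0) - T.objective η (W N) := fun N => by
    induction N with
    | zero => simp
    | succ N ih =>
      intro hN
      have h1 := ih fun j hj => hN j (hj.trans (Nat.lt_succ_self N))
      have h2 := hstep N
      have hLp := (hs N).L_pos hL (hW N)
      have h3 : s ≤ (2 * a - b ^ 2) / (2 * T.L ℓ ρ η (W N)) * ‖T.gradF η (W N)‖ ^ 2 := by
        have h4 := hLM N
        have h5 := (hN N (Nat.lt_succ_self N)).le
        rw [hsdef]
        gcongr
      push_cast
      linarith
  have hbound : ∀ N : ℕ, (∀ j < N, ε < ‖T.gradF η (W j)‖) →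
      (N : ℝ) ≤ (T.objective η (W 0) - T.optValue η) * (2 * M) / ((2 * a - b ^ 2) * ε ^ 2) :=
    fun N hN => by
      have h1 := hdec N hN
      have h2 := optValue_le ((hs N).mem_mamlStab hL (hW N))
      rw [le_div_iff₀ (by positivity)]
      have h3 : s * (2 * M) = (2 * a - b ^ 2) * ε ^ 2 := by
        rw [hsdef]
        field_simp
      rw [← h3, ← mul_assoc]
      exact mul_le_mul_of_nonneg_right (by linarith) (by positivity)
  have hex : ∃ N : ℕ, ‖T.gradF η (W N)‖ ≤ ε := by
    by_contra! hall
    obtain ⟨N, hN⟩ := exists_nat_gt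
      ((T.objective η (W 0) - T.optValue η) * (2 * M) / ((2 * a - b ^ 2) * ε ^ 2))
    exact absurd (hbound N fun j _ => hall j) (not_le.2 hN)
  -- N is the first index with small gradient: every earlier step lowers F by at least s, so Ns is
  -- at most the total decrease.
  classical
  exact ⟨Nat.find hex, hbound _ fun j hj => not_le.1 (Nat.find_min hex hj), Nat.find_spec hex⟩

theorem exists_cost_le (i : ι) {K : Set (Param m n)} (hK : IsCompact K) (hKs : K ⊆ T.stab) :
    ∃ c, ∀ W ∈ K, T.cost i W ≤ c := by
  obtain ⟨c, hc⟩ := (hK.image_of_continuousOn (f := T.cost i)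
    fun W hW => (continuousAt_cost i (hKs hW)).continuousWithinAt).bddAbove
  exact ⟨c, fun W hW => hc ⟨W, hW, rfl⟩⟩

end Tasks

end LQR

end

theorem mainTheorem1 {n m : ℕ} {ι : Type} [Fintype ι] (T : LQR.Tasks n m ι) :
    -- local Lipschitz constants exist
    (∃ ℓ ρ : ι → LQR.Param m n → ℝ, T.IsLipschitz ℓ ρ) ∧
    ∀ ℓ ρ : ι → LQR.Param m n → ℝ, T.IsLipschitz ℓ ρ →
      -- every iterate is stabilizing, and so are the adapted parameters
      (∀ (W : ℕ → LQR.Param m n) (α η β : ℕ → ℝ) (a b : ℝ),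
        W 0 ∈ T.stab → b ^ 2 < 2 * a → T.IsRun η β W →
        (∀ j, T.StepCondition ℓ ρ (α j) a b (η j) (β j) (W j)) →
        ∀ j, W j ∈ T.mamlStab (η j)) ∧
      -- the rate, with constants that do not depend on the accuracy `ε`
      ∀ 𝒲 : Set (LQR.Param m n), IsCompact 𝒲 → 𝒲 ⊆ T.stab → ∀ η : ℝ, 0 < η →
        ∃ c₁ > (0 : ℝ), ∃ c₂ > (0 : ℝ), ∀ σ : ℝ, 0 < σ → T.BoundedVariance 𝒲 σ →
          ∀ (W : ℕ → LQR.Param m n) (α β : ℕ → ℝ) (a b : ℝ),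
            W 0 ∈ 𝒲 → b ^ 2 < 2 * a → T.IsRun (fun _ => η) β W →
            (∀ j, T.StepCondition ℓ ρ (α j) a b η (β j) (W j)) →
            (∀ j i, β j * (T.gradF η (W j)).spec < α j * T.delta i (W j)) →
            ∀ ε : ℝ, 0 < ε → ∃ N : ℕ,
              (N : ℝ) ≤ (T.objective η (W 0) - T.optValue η) * (c₁ + c₂ * (σ + ε))
                / ((2 * a - b ^ 2) * ε ^ 2) ∧
              ‖T.gradF η (W N)‖ ≤ ε := by
  refine ⟨T.exists_isLipschitz, fun ℓ ρ hL => ⟨?_, ?_⟩⟩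
  · intro W α η β a b h0 hab hrun hs j
    exact (hs j).mem_mamlStab hL (hrun.mem_stab hL hab hs h0 j)
  · intro 𝒲 h𝒲 h𝒲s η hη
    by_cases hreg : ∀ i, T.Regular i
    · choose c hc using fun i => LQR.Tasks.exists_cost_le (T := T) i h𝒲 h𝒲s
      obtain ⟨M, hM⟩ := T.exists_L_le hreg hL hη (⨆ i, c i)
      -- The first constant alone carries the bound on 2L, and the positive term σ + ε only enlarges
      -- it. The maximum with 1 ensures positivity, as M need not be positive when no run exists.
      refine ⟨2 * max M 1, by positivity, 1, one_pos, ?_⟩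
      intro σ hσ _ W α β a b h0 hab hrun hs hβ ε hε
      have hobj : T.objective η (W 0) ≤ ⨆ i, c i :=
        (hs 0).objective_le hL (h𝒲s h0) fun i =>
          (hc i _ h0).trans (LQR.Tasks.le_iSup_index c i)
      obtain ⟨N, hN, hgrad⟩ := LQR.Tasks.exists_iteration hL
        (fun α a b β W h1 h2 h3 => (hM α a b β W h1 h2 h3).trans (le_max_left M 1))
        (h𝒲s h0) hobj hab hrun hs hβ hε
      refine ⟨N, hN.trans ?_, hgrad⟩
      have hΔ := LQR.Tasks.optValue_le ((hs 0).mem_mamlStab hL (h𝒲s h0))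
      have hab' : 0 < 2 * a - b ^ 2 := by linarith
      refine div_le_div_of_nonneg_right (mul_le_mul_of_nonneg_left ?_ (sub_nonneg.2 hΔ))
        (by positivity)
      linarith
    -- With degenerate data no run satisfies the step condition, so any constants serve.
    · refine ⟨1, one_pos, 1, one_pos, ?_⟩
      intro σ _ _ W α β a b _ _ _ hs
      exact absurd (fun i => (hs 0).regular i) hreg
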